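/- Consider an $n\times m$ board ($n$ rows, $m$ columns) whose squares carry the numbers $1,\dots,nm$, each exactly once, and let $1\le b\le\min(n,m)$. A move rotates one $b\times b$ block of adjacent squares by a multiple of $90^\circ$ (the numbers are carried along; their orientation is ignored). The solved board has the numbers in ascending order, row by row from the top and from left to right in each row. A configuration is called solvable if some finite sequence of moves takes it to the solved board. The parity of the square in row $i$ and column $j$ is the parity of $i+j$; a number lies in its correct parity if its square has the same parity as the square that it occupies in the solved board. Then: 1. If $b=n=m\ge 2$, there are exactly four solvable configurations, namely the four rotations (by $0^\circ,90^\circ,180^\circ,270^\circ$) of the solved board. 2. If $b=1$, the solved board is the only solvable configuration. Assume from now on that $b\ge 2$ and that $b=n=m$ does not hold. 3. Let $b=2$. If $(n,m)\in\{(2,3),(3,2)\}$, there are exactly $120$ solvable configurations. Otherwise all configurations are solvable. 4. Let $b=3$. If $(n,m)\in\{(3,4),(4,3)\}$, there are exactly $6!$ solvable configurations; moreover, in a solvable configuration all squares of even parity contain their correct number if and only if all squares of odd parity do. Otherwise the solvable configurations are exactly those that are even permutations of the solved board and in which each number lies in its correct parity. 5. Let $b\ge 4$. - If $b\equiv 2,6\pmod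 8$, all configurations are solvable. - If $b\equiv 0,4\pmod 8$, the solvable configurations are exactly the even permutations of the solved board. - If $b\equiv 3,5\pmod 8$, the solvable configurations are exactly the even permutations of the solved board in which each number lies in its correct parity. - If $b\equiv 1,7\pmod 8$, the solvable configurations are exactly those in which each number lies in its correct parity and, for each of the two parities, the numbers on the squares of that parity are an even permutation of their arrangement in the solved board. -/

import Mathlib

namespace NRP

/-- The squares of the board with `n` rows and `m` columns; `(i, j)` is the square in row `i`
(from the top) and column `j` (from the left), counted from `0`. -/
abbrev Square (n m : ℕ) := Fin n × Fin m

/-- A configuration assigns to each square the number lying on it, each of the `n * m` numbers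
being used once. The element `k : Fin (n * m)` stands for the number `k + 1`. -/
abbrev Config (n m : ℕ) := Square n m ≃ Fin (n * m)

/-- The solved board: the numbers in ascending order, row by row. -/
def solved (n m : ℕ) : Config n m where
  toFun p := ⟨p.1.val * m + p.2.val, by
    have h1 := p.1.isLt
    have h2 := p.2.isLt
    calc p.1.val * m + p.2.val < p.1.val * m + m := by omega
      _ = (p.1.val + 1) * m := by ring
      _ ≤ n * m := Nat.mul_le_mul_right m h1⟩
  invFun k := (⟨k.val / m, Nat.div_lt_of_lt_mul (lt_of_lt_of_eq k.isLt (Nat.mul_comm n m))⟩,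
    ⟨k.val % m, Nat.mod_lt _ (Nat.pos_of_ne_zero (by
      rintro rfl
      exact absurd k.isLt (by simp)))⟩)
  left_inv := by
    rintro ⟨⟨i, hi⟩, ⟨j, hj⟩⟩
    have hm : 0 < m := by omega
    simp only [Prod.mk.injEq, Fin.mk.injEq]
    constructor
    · rw [Nat.mul_comm, Nat.mul_add_div hm, Nat.div_eq_of_lt hj, Nat.add_zero]
    · rw [Nat.mul_comm, Nat.mul_add_mod, Nat.mod_eq_of_lt hj]
  right_inv := by
    rintro ⟨k, hk⟩
    simp only [Fin.mk.injEq]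
    exact Nat.div_add_mod' k m

/-- The square `p` lies in the `b × b` block whose upper-left square is `(r, s)`. -/
abbrev InBlock {n m : ℕ} (b r s : ℕ) (p : Square n m) : Prop :=
  (r ≤ p.1.val ∧ p.1.val < r + b) ∧ (s ≤ p.2.val ∧ p.2.val < s + b)

/-- The permutation of the squares given by the counter-clockwise rotation by `90°` of the
`b × b` block with upper-left square `(r, s)`: the content of `(r + x, s + y)` moves to
`(r + (b - 1 - y), s + x)` for `0 ≤ x, y < b`, and all squares outside the block are fixed. -/
def blockRot {n m b r s : ℕ} (hr : r + b ≤ n) (hs : s + b ≤ m) :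
    Equiv.Perm (Square n m) where
  toFun p :=
    if h : InBlock b r s p then
      (⟨r + (b - 1 - (p.2.val - s)), by omega⟩,
        ⟨s + (p.1.val - r), by omega⟩)
    else p
  invFun p :=
    if h : InBlock b r s p then
      (⟨r + (p.2.val - s), by omega⟩,
        ⟨s + (b - 1 - (p.1.val - r)), by omega⟩)
    else p
  left_inv := by
    rintro ⟨⟨i, hi⟩, ⟨j, hj⟩⟩
    by_cases h : InBlock b r s ((⟨i, hi⟩, ⟨j, hj⟩) : Square n m)
    · beta_reduce
      rw [dif_pos h, dif_pos (by simp only [InBlock] at h ⊢; omega)]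
      simp only [InBlock] at h
      simp only [Prod.mk.injEq, Fin.mk.injEq]
      omega
    · beta_reduce
      rw [dif_neg h, dif_neg h]
  right_inv := by
    rintro ⟨⟨i, hi⟩, ⟨j, hj⟩⟩
    by_cases h : InBlock b r s ((⟨i, hi⟩, ⟨j, hj⟩) : Square n m)
    · beta_reduce
      rw [dif_pos h, dif_pos (by simp only [InBlock] at h ⊢; omega)]
      simp only [InBlock] at h
      simp only [Prod.mk.injEq, Fin.mk.injEq]
      omega
    · beta_reduce
      rw [dif_neg h, dif_neg h]

/-- `Move b c c'`: the configuration `c'` arises from `c` by rotating one `b × b` block by some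
multiple of `90°`; the number at `p` moves to the square `(blockRot hr hs ^ k) p`. -/
def Move {n m : ℕ} (b : ℕ) (c c' : Config n m) : Prop :=
  ∃ (r s : ℕ) (hr : r + b ≤ n) (hs : s + b ≤ m) (k : ℕ),
    ∀ p : Square n m, c' ((blockRot hr hs ^ k) p) = c p

/-- The solved board can be reached from `c` by finitely many moves. -/
def Solvable {n m : ℕ} (b : ℕ) (c : Config n m) : Prop :=
  Relation.ReflTransGen (Move b) c (solved n m)

/-- The whole square board turned counter-clockwise by `90°`: the number at `(i, j)` goes to
`(n - 1 - j, i)`. -/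
def rotateBoard {n : ℕ} (c : Config n n) : Config n n where
  toFun p := c (p.2, Fin.rev p.1)
  invFun k := (Fin.rev (c.symm k).2, (c.symm k).1)
  left_inv p := by simp
  right_inv k := by simp

/-- The checkerboard parity of a square: the parity of its coordinate sum. -/
def parity {n m : ℕ} (p : Square n m) : ℕ := (p.1.val + p.2.val) % 2

/-- The configuration as a permutation of the solved board: each square is sent to the square
on which its number lies in the solved board. -/
def toPerm {n m : ℕ} (c : Config n m) : Equiv.Perm (Square n m) :=
  c.trans (solved n m).symm

/-- The configuration is an even permutation of the solved board. -/
def IsEven {n m : ℕ} (c : Config n m) : Prop :=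
  Equiv.Perm.sign (toPerm c) = 1

/-- Each number lies on a square of its correct parity, i.e. of the same parity as the square
of this number in the solved board. -/
def CorrectParity {n m : ℕ} (c : Config n m) : Prop :=
  ∀ p : Square n m, parity (toPerm c p) = parity p

/-- The squares of parity `q` contain the same numbers as in the solved board, and these are
an even permutation of their solved state. -/
def IsEvenOn {n m : ℕ} (q : ℕ) (c : Config n m) : Prop :=
  ∃ h : ∀ p : Square n m, parity (toPerm c p) = q ↔ parity p = q,
    Equiv.Perm.sign
      (Equiv.Perm.subtypePerm (p := fun p : Square n m => parity p = q) (toPerm c) h) = 1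

/-- All squares of parity `q` contain their correct number. -/
def SolvedOn {n m : ℕ} (q : ℕ) (c : Config n m) : Prop :=
  ∀ p : Square n m, parity p = q → c p = solved n m p

end NRP

/-! A configuration is solvable exactly when its permutation of the squares lies in the group
`rotGroup b n m` generated by the block rotations, so the task is to determine this group.

Generic boards. Call two squares linked if they are equal or lie on a common 3-cycle of the group.
This is an equivalence relation, and the group permutes its classes. If a set of squares lies in one
class, the group contains all even permutations of that set, since 3-cycles generate the alternating
group. The central claim `Conn` says that all squares are linked for even `b`, and all squares of
one colour for odd `b`. Linkedness passes from a board to larger boards, so small boards suffice: `b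
× (b + 1)` for `b ≥ 4`, and four boards for `b = 2, 3`. For `b ≥ 5` the product `edgeShift` of four
rotations moves only squares on three edges. A suitable conjugate of it meets these edges in a
single moved square, so the commutator of the two is a 3-cycle. It joins the first column to the
last, and `linked_of_columns` spreads it over the colour class. The small boards are settled by
explicit words and evaluation.

What remains is parity. A rotation consists of 4-cycles only: `b² / 4` of them for even `b`, and
`(b² - 1) / 8` on each colour for odd `b`, where colours are preserved. The parities of these
numbers give the residue classes modulo 8.

Exceptional boards. On the `2 × 3` board the rotations act as projective maps on the six points of
the line over the field with five elements, and the group is sharply 3-transitive, of order 6 · 5 ·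
4. On the `3 × 4` board the group induces the full symmetric group on the six even squares. The
actions on the two colours determine each other through the exceptional correspondence of degree
six, in which pairs of odd squares match fixed-point-free involutions of the even squares. -/

namespace NRP

open Equiv

/-! ### Three-cycles in a permutation group and the even permutations they generate -/

section Linked

variable {α β : Type*} [DecidableEq α] [DecidableEq β]

/-- The 3-cycle `x ↦ y ↦ z ↦ x` (for distinct `x`, `y`, `z`). -/
def cycle3 (x y z : α) : Perm α := swap x y * swap y z

theorem cycle3_inv (x y z : α) : (cycle3 x y z)⁻¹ = cycle3 z y x := by
  simp [cycle3, swap_comm]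

theorem cycle3_rotate {x y z : α} (hxy : x ≠ y) (hyz : y ≠ z) (hxz : x ≠ z) :
    cycle3 x y z = cycle3 y z x := by
  ext p
  simp only [cycle3, Perm.mul_apply, swap_apply_def]
  grind

theorem conj_cycle3 (g : Perm α) (x y z : α) :
    g * cycle3 x y z * g⁻¹ = cycle3 (g x) (g y) (g z) := by
  have h (a b : α) : swap (g a) (g b) = g * swap a b * g⁻¹ := Equiv.swap_apply_apply g a b
  simp only [cycle3, h]
  group

/-- `x` and `y` are equal or lie on a common 3-cycle belonging to `G`. -/
def Linked (G : Subgroup (Perm α)) (x y : α) : Prop :=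
  x = y ∨ ∃ z, x ≠ y ∧ y ≠ z ∧ x ≠ z ∧ cycle3 x y z ∈ G

variable {G : Subgroup (Perm α)}

theorem cycle3_mem_rotate {x y z : α} (hxy : x ≠ y) (hyz : y ≠ z) (hxz : x ≠ z)
    (h : cycle3 x y z ∈ G) : cycle3 y z x ∈ G := by
  rwa [← cycle3_rotate hxy hyz hxz]

theorem cycle3_mem_reverse {x y z : α} (h : cycle3 x y z ∈ G) : cycle3 z y x ∈ G := by
  rw [← cycle3_inv]
  exact G.inv_mem h

theorem conj_cycle3_mem {g : Perm α} {x y z : α} (hg : g ∈ G) (h : cycle3 x y z ∈ G) :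
    cycle3 (g x) (g y) (g z) ∈ G := by
  rw [← conj_cycle3]
  exact G.mul_mem (G.mul_mem hg h) (G.inv_mem hg)

theorem Linked.refl (x : α) : Linked G x x := Or.inl rfl

theorem Linked.symm {x y : α} (h : Linked G x y) : Linked G y x := by
  rcases h with rfl | ⟨z, hxy, hyz, hxz, h⟩
  · exact Linked.refl _
  · refine Or.inr ⟨z, hxy.symm, hxz, hyz, ?_⟩
    exact cycle3_mem_rotate hyz.symm hxy.symm hxz.symm (cycle3_mem_reverse h)

/-- Two 3-cycles `x y u` and `y z v` share the point `y`. Either one of them already runs through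
`x`, `y`, `z`, or conjugating one by the other, at most twice, yields a 3-cycle on these points with
the required orientation. -/
theorem cycle3_mem_of_linked {x y z : α} (hxy : x ≠ y) (hyz : y ≠ z) (hxz : x ≠ z)
    (h1 : Linked G x y) (h2 : Linked G y z) : cycle3 x y z ∈ G := by
  rcases h1 with h1 | ⟨u, -, hyu, hxu, h1⟩
  · exact absurd h1 hxy
  rcases h2 with h2 | ⟨v, -, hzv, hyv, h2⟩
  · exact absurd h2 hyz
  have act : ∀ {a b c : α}, a ≠ b → b ≠ c → a ≠ c →
      cycle3 a b c a = b ∧ cycle3 a b c b = c ∧ cycle3 a b c c = a ∧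
        ∀ d, d ≠ a → d ≠ b → d ≠ c → cycle3 a b c d = d := by
    intro a b c hab hbc hac
    refine ⟨?_, ?_, ?_, fun d ha hb hc => ?_⟩ <;>
      simp only [cycle3, Perm.mul_apply, swap_apply_def] <;> grind
  by_cases huz : u = z
  · rwa [← huz]
  by_cases hvx : v = x
  · subst hvx
    exact cycle3_mem_rotate hxz.symm hxy hyz.symm (cycle3_mem_rotate hyz hzv hyv h2)
  by_cases hvu : v = u
  · subst hvu
    have h3 := conj_cycle3_mem h2 h1
    obtain ⟨e1, e2, e3, e4⟩ := act hyz hzv hyv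
    rw [e4 x hxy hxz hxu, e1, e3] at h3
    have h4 := cycle3_mem_reverse h3
    exact cycle3_mem_rotate hxz.symm hxy hyz.symm (cycle3_mem_rotate hyz hxz.symm hxy.symm h4)
  · have h3 := conj_cycle3_mem h2 h1
    obtain ⟨e1, e2, e3, e4⟩ := act hyz hzv hyv
    rw [e4 x hxy hxz (Ne.symm hvx), e1, e4 u hyu.symm huz (Ne.symm hvu)] at h3
    have h5 := conj_cycle3_mem h3 h1
    obtain ⟨f1, f2, f3, f4⟩ := act hxz (Ne.symm huz) hxu
    rw [f1, f4 y hxy.symm hyz hyu, f3] at h5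
    exact cycle3_mem_reverse h5

theorem Linked.trans {x y z : α} (h1 : Linked G x y) (h2 : Linked G y z) : Linked G x z := by
  by_cases hxy : x = y
  · rwa [hxy]
  by_cases hyz : y = z
  · rwa [← hyz]
  by_cases hxz : x = z
  · exact Or.inl hxz
  have h := cycle3_mem_of_linked hxy hyz hxz h1 h2
  exact Or.inr ⟨y, hxz, Ne.symm hyz, hxy,
    cycle3_mem_reverse (cycle3_mem_rotate hxy hyz hxz h)⟩

theorem Linked.apply {g : Perm α} (hg : g ∈ G) {x y : α} (h : Linked G x y) :
    Linked G (g x) (g y) := by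
  rcases h with rfl | ⟨z, hxy, hyz, hxz, h⟩
  · exact Linked.refl _
  · exact Or.inr ⟨g z, g.injective.ne hxy, g.injective.ne hyz, g.injective.ne hxz,
      conj_cycle3_mem hg h⟩

/-- A class of linked points is stable under every element of `G` that fixes one of its points. -/
theorem Linked.apply_of_fixed {g : Perm α} (hg : g ∈ G) {x a y : α} (ha : Linked G x a)
    (hga : g a = a) (hy : Linked G x y) : Linked G x (g y) := by
  have h := (ha.symm.trans hy).apply hg
  rw [hga] at h
  exact ha.trans h

theorem linked_of_cycle3_mem {x y z : α} (hxy : x ≠ y) (hyz : y ≠ z) (hxz : x ≠ z)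
    (h : cycle3 x y z ∈ G) : Linked G x y ∧ Linked G x z :=
  ⟨Or.inr ⟨z, hxy, hyz, hxz, h⟩,
    Linked.symm (Or.inr ⟨y, hxz.symm, hxy, hyz.symm,
      cycle3_mem_rotate hyz hxz.symm hxy.symm (cycle3_mem_rotate hxy hyz hxz h)⟩)⟩

/-- The commutator of two permutations whose supports meet in a single point is a 3-cycle. -/
theorem commutator_eq_cycle3 {E F : Perm α} {x : α} (hE : E x ≠ x) (hF : F x ≠ x)
    (h : ∀ p, E p ≠ p → F p ≠ p → p = x) : E * F * E⁻¹ * F⁻¹ = cycle3 x (E x) (F x) := by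
  have hEF : F (E x) = E x := by
    by_contra hc
    exact hE (h _ (fun hh => hE (E.injective hh)) hc)
  have hFE : E (F x) = F x := by
    by_contra hc
    exact hF (h _ hc (fun hh => hF (F.injective hh)))
  have hne : E x ≠ F x := by
    intro hc
    rw [← hc] at hFE
    exact hE (E.injective hFE)
  -- Comparing `E * F` with `F * E` pointwise avoids inverses. The two products differ only where
  -- one of the maps hits `x` or starts from it.
  have key : E * F = cycle3 x (E x) (F x) * (F * E) := by
    ext p
    simp only [Perm.mul_apply]
    have hx : cycle3 x (E x) (F x) x = E x := by
      simp [cycle3, swap_apply_def, hE.symm, hF.symm]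
    have hEx : cycle3 x (E x) (F x) (E x) = F x := by
      simp [cycle3, swap_apply_def, hF, hne.symm]
    have hFx : cycle3 x (E x) (F x) (F x) = x := by
      simp [cycle3]
    have ho : ∀ q, q ≠ x → q ≠ E x → q ≠ F x → cycle3 x (E x) (F x) q = q := by
      intro q h1 h2 h3
      simp [cycle3, swap_apply_def, h1, h2, h3]
    by_cases hpx : p = x
    · subst hpx
      rw [hEF, hEx, hFE]
    by_cases hEp : E p = p
    · rw [hEp]
      by_cases hFp : F p = x
      · rw [hFp, hx]
      · by_cases hFp' : F p = p
        · rw [hFp', hEp, ho p hpx]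
          · rintro rfl
            exact hE (E.injective hEp)
          · rintro rfl
            exact hF (F.injective hFp')
        · have h1 : E (F p) = F p := by
            by_contra hc
            exact hFp (h _ hc (fun hh => hFp' (F.injective hh)))
          rw [h1, ho _ hFp]
          · intro hc
            rw [hc] at h1
            exact hE (E.injective h1)
          · intro hc
            exact hpx (F.injective hc)
    · have hFp : F p = p := by
        by_contra hc
        exact hpx (h _ hEp hc)
      rw [hFp]
      by_cases hq : E p = x
      · rw [hq, hFx]
      · have h1 : F (E p) = E p := by
          by_contra hc
          exact hq (h _ (fun hh => hEp (E.injective hh)) hc)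
        rw [h1, ho _ hq]
        · intro hc
          exact hpx (E.injective hc)
        · intro hc
          rw [hc] at h1
          exact hF (F.injective h1)
  rw [mul_assoc, ← mul_inv_rev, key, mul_inv_cancel_right]

theorem Linked.map {H : Subgroup (Perm β)} (φ : Perm α →* Perm β) (f : α → β)
    (hf : Function.Injective f) (hφ : ∀ x y z, φ (cycle3 x y z) = cycle3 (f x) (f y) (f z))
    (hG : G.map φ ≤ H) {x y : α} (h : Linked G x y) : Linked H (f x) (f y) := by
  rcases h with rfl | ⟨z, hxy, hyz, hxz, h⟩
  · exact Linked.refl _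
  · refine Or.inr ⟨f z, hf.ne hxy, hf.ne hyz, hf.ne hxz, ?_⟩
    rw [← hφ]
    exact hG ⟨_, h, rfl⟩

/-- If all points satisfying `P` are linked, `G` contains the even permutations of these points. -/
theorem ofSubtype_mem_of_linked [Fintype α] {P : α → Prop} [DecidablePred P]
    (h : ∀ x y, P x → P y → Linked G x y) (τ : Perm {x // P x}) (hτ : Perm.sign τ = 1) :
    Perm.ofSubtype τ ∈ G := by
  have h1 : τ ∈ alternatingGroup {x // P x} := hτ
  rw [← Perm.closure_three_cycles_eq_alternating] at h1
  suffices hle : Subgroup.closure {σ : Perm {x // P x} | Perm.IsThreeCycle σ} ≤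
      G.comap Perm.ofSubtype from hle h1
  rw [Subgroup.closure_le]
  intro σ hσ
  obtain ⟨a, ha⟩ := Perm.IsCycle.nonempty_support (Perm.IsThreeCycle.isCycle hσ)
  have hnd := (Perm.IsThreeCycle.nodup_iff_mem_support hσ).mpr ha
  have heq := (Perm.IsThreeCycle.eq_swap_mul_swap_iff_mem_support hσ).mpr ha
  simp only [List.nodup_cons, List.mem_cons, List.not_mem_nil, or_false, not_or] at hnd
  obtain ⟨⟨h1, h2⟩, h3, -⟩ := hnd
  simp only [Subgroup.coe_comap, Set.mem_preimage, SetLike.mem_coe]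
  rw [heq, map_mul, Perm.ofSubtype_swap_eq, Perm.ofSubtype_swap_eq]
  exact cycle3_mem_of_linked (fun hc => h1 (Subtype.ext hc)) (fun hc => h3 (Subtype.ext hc))
    (fun hc => h2 (Subtype.ext hc)) (h _ _ a.2 (σ a).2) (h _ _ (σ a).2 (σ (σ a)).2)

theorem mem_of_linked [Fintype α] (h : ∀ x y, Linked G x y) (τ : Perm α)
    (hτ : Perm.sign τ = 1) : τ ∈ G := by
  have h1 := ofSubtype_mem_of_linked (P := fun _ : α => True) (fun x y _ _ => h x y)
    (τ.subtypePerm (fun _ => Iff.rfl)) (by rw [Perm.sign_subtypePerm _ _ (by simp), hτ])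
  rwa [Perm.ofSubtype_subtypePerm _ (fun _ _ => trivial)] at h1

/-- Enlarge `S` by its image under `g`, provided that `g` fixes a point of `S`. -/
def grow (g : Perm α) (S : Finset α) : Finset α :=
  if ∃ a ∈ S, g a = a then S ∪ S.image g else S

theorem linked_foldr_grow {gs : List (Perm α)} (hgs : ∀ g ∈ gs, g ∈ G) {x : α} {S : Finset α}
    (hS : ∀ y ∈ S, Linked G x y) : ∀ y ∈ gs.foldr grow S, Linked G x y := by
  induction gs with
  | nil => exact hS
  | cons g gs ih =>
    have ih := ih fun g' hg' => hgs g' (List.mem_cons_of_mem _ hg')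
    intro y hy
    rw [List.foldr_cons, grow] at hy
    split_ifs at hy with hfix
    · obtain ⟨a, ha, hga⟩ := hfix
      rcases Finset.mem_union.mp hy with hy | hy
      · exact ih y hy
      · obtain ⟨z, hz, rfl⟩ := Finset.mem_image.mp hy
        exact (ih a ha).apply_of_fixed (hgs g List.mem_cons_self) hga (ih z hz)
    · exact ih y hy

/-- Iterated enlargement, along the permutations of `gs`, of a set of linked points. -/
theorem linked_iterate_grow {gs : List (Perm α)} (hgs : ∀ g ∈ gs, g ∈ G) {x : α}
    {S : Finset α} (hS : ∀ y ∈ S, Linked G x y) (k : ℕ) :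
    ∀ y ∈ (fun T => gs.foldr grow T)^[k] S, Linked G x y := by
  induction k with
  | zero => exact hS
  | succ k ih =>
    rw [Function.iterate_succ_apply']
    exact linked_foldr_grow hgs ih

end Linked

/-! ### The rotation group, and transfer of linkedness to larger and transposed boards -/

section Rotations

variable {n m b r s : ℕ}

theorem blockRot_fst_of_mem (hr : r + b ≤ n) (hs : s + b ≤ m) {p : Square n m}
    (h : InBlock b r s p) : (blockRot hr hs p).1.val = r + (b - 1 - (p.2.val - s)) := by
  simp only [blockRot, Equiv.coe_fn_mk, dif_pos h]

theorem blockRot_snd_of_mem (hr : r + b ≤ n) (hs : s + b ≤ m) {p : Square n m}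
    (h : InBlock b r s p) : (blockRot hr hs p).2.val = s + (p.1.val - r) := by
  simp only [blockRot, Equiv.coe_fn_mk, dif_pos h]

theorem blockRot_of_notMem (hr : r + b ≤ n) (hs : s + b ≤ m) {p : Square n m}
    (h : ¬ InBlock b r s p) : blockRot hr hs p = p := by
  simp only [blockRot, Equiv.coe_fn_mk, dif_neg h]

/-- The row and column of a square. -/
def coords (p : Square n m) : ℕ × ℕ := (p.1.val, p.2.val)

theorem coords_injective : Function.Injective (coords : Square n m → ℕ × ℕ) := by
  rintro ⟨p1, p2⟩ ⟨q1, q2⟩ h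
  simp only [coords, Prod.mk.injEq] at h
  exact Prod.ext (Fin.ext h.1) (Fin.ext h.2)

/-- The rotation of a block on the level of coordinates. -/
def rotFun (b r s : ℕ) (p : ℕ × ℕ) : ℕ × ℕ :=
  if (r ≤ p.1 ∧ p.1 < r + b) ∧ (s ≤ p.2 ∧ p.2 < s + b) then
    (r + (b - 1 - (p.2 - s)), s + (p.1 - r)) else p

theorem coords_blockRot (hr : r + b ≤ n) (hs : s + b ≤ m) (p : Square n m) :
    coords (blockRot hr hs p) = rotFun b r s (coords p) := by
  by_cases h : InBlock b r s p
  · exact (Prod.ext (blockRot_fst_of_mem hr hs h) (blockRot_snd_of_mem hr hs h) :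
      coords _ = (_, _)).trans (if_pos h).symm
  · rw [blockRot_of_notMem hr hs h]
    exact (if_neg h).symm

/-- The inverse rotation of a block on the level of coordinates. -/
def rotFunInv (b r s : ℕ) (p : ℕ × ℕ) : ℕ × ℕ :=
  if (r ≤ p.1 ∧ p.1 < r + b) ∧ (s ≤ p.2 ∧ p.2 < s + b) then
    (r + (p.2 - s), s + (b - 1 - (p.1 - r))) else p

theorem coords_blockRot_inv (hr : r + b ≤ n) (hs : s + b ≤ m) (p : Square n m) :
    coords ((blockRot hr hs)⁻¹ p) = rotFunInv b r s (coords p) := by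
  obtain ⟨q, rfl⟩ := (blockRot hr hs).surjective p
  rw [← Perm.mul_apply, inv_mul_cancel, Perm.one_apply, coords_blockRot]
  obtain ⟨i, j⟩ := coords q
  simp only [rotFun]
  split_ifs with h
  · rw [rotFunInv, if_pos (by simp only at *; omega)]
    ext <;> simp only at * <;> omega
  · rw [rotFunInv, if_neg h]

theorem rotFun_of_mem {i j : ℕ} (h : (r ≤ i ∧ i < r + b) ∧ (s ≤ j ∧ j < s + b)) :
    rotFun b r s (i, j) = (r + (b - 1 - (j - s)), s + (i - r)) := if_pos h

theorem rotFun_four (b r s : ℕ) (p : ℕ × ℕ) :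
    rotFun b r s (rotFun b r s (rotFun b r s (rotFun b r s p))) = p := by
  obtain ⟨i, j⟩ := p
  by_cases h : (r ≤ i ∧ i < r + b) ∧ (s ≤ j ∧ j < s + b)
  · rw [rotFun_of_mem h]
    rw [rotFun_of_mem (i := r + _) (by omega)]
    rw [rotFun_of_mem (i := r + _) (by omega)]
    rw [rotFun_of_mem (i := r + _) (by omega), Prod.mk.injEq]
    omega
  · have h1 : rotFun b r s (i, j) = (i, j) := if_neg h
    simp only [h1]

theorem blockRot_pow_four (hr : r + b ≤ n) (hs : s + b ≤ m) :
    (blockRot hr hs : Perm (Square n m)) ^ 4 = 1 := by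
  ext1 p
  apply coords_injective
  simp only [pow_succ, pow_zero, one_mul, Perm.mul_apply, coords_blockRot, rotFun_four,
    Perm.one_apply]

/-- The group generated by the rotations of the `b × b` blocks of the `n × m` board. -/
def rotGroup (b n m : ℕ) : Subgroup (Perm (Square n m)) :=
  Subgroup.closure {σ | ∃ (r s : ℕ) (hr : r + b ≤ n) (hs : s + b ≤ m), σ = blockRot hr hs}

theorem blockRot_mem (hr : r + b ≤ n) (hs : s + b ≤ m) :
    (blockRot hr hs : Perm (Square n m)) ∈ rotGroup b n m :=
  Subgroup.subset_closure ⟨r, s, hr, hs, rfl⟩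

theorem toPerm_trans (g : Perm (Square n m)) (c : Config n m) :
    toPerm (g.trans c) = toPerm c * g := rfl

theorem toPerm_solved : toPerm (solved n m) = 1 := Equiv.self_trans_symm _

theorem toPerm_trans_solved (g : Perm (Square n m)) : toPerm (g.trans (solved n m)) = g := by
  rw [toPerm_trans, toPerm_solved, one_mul]

theorem trans_toPerm (c : Config n m) : (toPerm c).trans (solved n m) = c := by
  ext1 p
  simp [toPerm]

theorem toPerm_injective : Function.Injective (toPerm : Config n m → Perm (Square n m)) := by
  intro c d h
  rw [← trans_toPerm c, h, trans_toPerm d]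

/-- A move multiplies `toPerm` on the right by a power of a block rotation, and the solved board
corresponds to the identity. -/
theorem solvable_iff (c : Config n m) : Solvable b c ↔ toPerm c ∈ rotGroup b n m := by
  constructor
  · intro h
    induction h using Relation.ReflTransGen.head_induction_on with
    | refl => rw [toPerm_solved]; exact one_mem _
    | @head c c' hmove _ ih =>
      obtain ⟨r, s, hr, hs, k, hk⟩ := hmove
      have : c = (blockRot hr hs ^ k).trans c' := by
        ext1 p
        exact (hk p).symm
      rw [this, toPerm_trans]
      exact mul_mem ih (pow_mem (blockRot_mem hr hs) k)
  · have key : ∀ g ∈ rotGroup b n m, ∀ d : Config n m,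
        Solvable b (g.trans d) ↔ Solvable b d := by
      intro g hg
      induction hg using Subgroup.closure_induction with
      | mem g hg =>
        obtain ⟨r, s, hr, hs, rfl⟩ := hg
        intro d
        constructor
        -- Three quarter turns undo one.
        · refine fun h => Relation.ReflTransGen.head ⟨r, s, hr, hs, 3, fun p => ?_⟩ h
          change d ((blockRot hr hs * blockRot hr hs ^ 3) p) = d p
          rw [← pow_succ', blockRot_pow_four, Perm.one_apply]
        · refine fun h => Relation.ReflTransGen.head ⟨r, s, hr, hs, 1, fun p => ?_⟩ h
          rw [pow_one]
          rfl
      | one => exact fun d => Iff.rfl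
      | mul x y _ _ hx hy =>
        intro d
        exact (hy (x.trans d)).trans (hx d)
      | inv x _ hx =>
        intro d
        have h := hx ((x⁻¹ : Perm _).trans d)
        have e : x.trans ((x⁻¹ : Perm _).trans d) = d := by
          ext1 p
          simp
        rw [e] at h
        exact h.symm
    intro h
    rw [← trans_toPerm c]
    exact (key _ h _).mpr Relation.ReflTransGen.refl

theorem ncard_solvable (b n m : ℕ) :
    {c : Config n m | Solvable b c}.ncard = Nat.card (rotGroup b n m) := by
  have : (rotGroup b n m : Set (Perm (Square n m))) = toPerm '' {c : Config n m | Solvable b c} := by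
    ext g
    simp only [SetLike.mem_coe, Set.mem_image, Set.mem_ofPred_eq, solvable_iff]
    exact ⟨fun h => ⟨_, by rwa [toPerm_trans_solved], toPerm_trans_solved g⟩,
      by rintro ⟨c, hc, rfl⟩; exact hc⟩
  rw [← Set.ncard_image_of_injective _ toPerm_injective, ← this]
  rfl

/-- The inclusion of a smaller board with its upper-left square at `(r, s)`. -/
def boardEmb {n' m' : ℕ} (r s : ℕ) (hr : r + n' ≤ n) (hs : s + m' ≤ m) :
    Square n' m' ↪ Square n m where
  toFun p := (⟨r + p.1.val, by omega⟩, ⟨s + p.2.val, by omega⟩)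
  inj' := by
    rintro ⟨p1, p2⟩ ⟨q1, q2⟩ h
    simp only [Prod.mk.injEq, Fin.mk.injEq] at h
    exact Prod.ext (Fin.ext (by simp only; omega)) (Fin.ext (by simp only; omega))

theorem coords_boardEmb {n' m' : ℕ} (hr : r + n' ≤ n) (hs : s + m' ≤ m) (q : Square n' m') :
    coords (boardEmb r s hr hs q) = (r + (coords q).1, s + (coords q).2) := rfl

theorem viaEmbedding_swap {α β : Type*} [DecidableEq α] [DecidableEq β] (f : α ↪ β) (x y : α) :
    Perm.viaEmbedding (swap x y) f = swap (f x) (f y) := by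
  ext p
  by_cases hp : p ∈ Set.range f
  · obtain ⟨q, rfl⟩ := hp
    rw [Perm.viaEmbedding_apply, swap_apply_def, swap_apply_def]
    simp only [f.injective.eq_iff]
    split_ifs <;> rfl
  · rw [Perm.viaEmbedding_apply_of_notMem _ _ _ hp, swap_apply_of_ne_of_ne]
    · rintro rfl; exact hp ⟨_, rfl⟩
    · rintro rfl; exact hp ⟨_, rfl⟩

theorem viaEmbedding_blockRot {n' m' r' s' : ℕ} (hr' : r' + b ≤ n') (hs' : s' + b ≤ m')
    (hr : r + n' ≤ n) (hs : s + m' ≤ m) :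
    Perm.viaEmbedding (blockRot hr' hs') (boardEmb r s hr hs) =
      blockRot (b := b) (r := r + r') (s := s + s') (by omega) (by omega) := by
  ext1 p
  apply coords_injective
  rw [coords_blockRot]
  by_cases hp : p ∈ Set.range (boardEmb r s hr hs)
  · obtain ⟨q, rfl⟩ := hp
    rw [Perm.viaEmbedding_apply]
    rw [coords_boardEmb, coords_boardEmb, coords_blockRot]
    obtain ⟨i, j⟩ := coords q
    simp only [rotFun]
    by_cases h : (r' ≤ i ∧ i < r' + b) ∧ (s' ≤ j ∧ j < s' + b)
    · rw [if_pos h, if_pos (by omega)]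
      ext <;> simp only <;> omega
    · rw [if_neg h, if_neg (by omega)]
  · rw [Perm.viaEmbedding_apply_of_notMem _ _ _ hp, rotFun, if_neg]
    intro h
    apply hp
    obtain ⟨⟨i, hi⟩, ⟨j, hj⟩⟩ := p
    simp only [coords] at h
    refine ⟨(⟨i - r, by omega⟩, ⟨j - s, by omega⟩), ?_⟩
    apply coords_injective
    rw [coords_boardEmb]
    simp only [coords, Prod.mk.injEq]
    omega

theorem Linked.boardEmb {n' m' : ℕ} (hr : r + n' ≤ n) (hs : s + m' ≤ m) {p q : Square n' m'}
    (h : Linked (rotGroup b n' m') p q) :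
    Linked (rotGroup b n m) (boardEmb r s hr hs p) (boardEmb r s hr hs q) := by
  refine h.map (Perm.viaEmbeddingHom (NRP.boardEmb r s hr hs)) _
    (NRP.boardEmb r s hr hs).injective ?_ ?_
  · intro x y z
    rw [cycle3, map_mul, Perm.viaEmbeddingHom_apply, Perm.viaEmbeddingHom_apply,
      viaEmbedding_swap, viaEmbedding_swap]
    rfl
  · rw [rotGroup, MonoidHom.map_closure, Subgroup.closure_le]
    rintro _ ⟨_, ⟨r', s', hr', hs', rfl⟩, rfl⟩
    rw [Perm.viaEmbeddingHom_apply, viaEmbedding_blockRot]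
    exact blockRot_mem _ _

/-- Conjugation by the transposition of the board. -/
def transposeHom (n m : ℕ) : Perm (Square n m) →* Perm (Square m n) :=
  (Equiv.permCongrHom (Equiv.prodComm (Fin n) (Fin m))).toMonoidHom

theorem transposeHom_apply (σ : Perm (Square n m)) (p : Square m n) :
    transposeHom n m σ p = (σ p.swap).swap := rfl

/-- Transposition is a reflection, so it reverses the sense of a rotation. -/
theorem transposeHom_blockRot (hr : r + b ≤ n) (hs : s + b ≤ m) :
    transposeHom n m (blockRot hr hs) = (blockRot hs hr)⁻¹ := by
  ext1 p
  apply coords_injective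
  rw [transposeHom_apply, coords_blockRot_inv]
  have e : ∀ {n m : ℕ} (q : Square n m), coords q.swap = (coords q).swap := fun _ => rfl
  rw [e, coords_blockRot, e]
  obtain ⟨i, j⟩ := coords p
  simp only [rotFun, rotFunInv, Prod.swap]
  by_cases h : (s ≤ i ∧ i < s + b) ∧ (r ≤ j ∧ j < r + b)
  · rw [if_pos h, if_pos h.symm]
  · rw [if_neg h, if_neg (fun hc => h hc.symm)]

theorem map_transposeHom_le (b n m : ℕ) :
    (rotGroup b n m).map (transposeHom n m) ≤ rotGroup b m n := by
  rw [rotGroup, MonoidHom.map_closure, Subgroup.closure_le]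
  rintro _ ⟨_, ⟨r', s', hr', hs', rfl⟩, rfl⟩
  rw [transposeHom_blockRot]
  exact inv_mem (blockRot_mem _ _)

theorem transposeHom_mem {σ : Perm (Square n m)} (h : σ ∈ rotGroup b n m) :
    transposeHom n m σ ∈ rotGroup b m n :=
  map_transposeHom_le b n m ⟨σ, h, rfl⟩

theorem card_rotGroup_transpose (b n m : ℕ) :
    Nat.card (rotGroup b n m) = Nat.card (rotGroup b m n) :=
  Nat.card_congr
    { toFun := fun σ => ⟨_, transposeHom_mem σ.2⟩
      invFun := fun σ => ⟨_, transposeHom_mem σ.2⟩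
      left_inv := fun _ => rfl
      right_inv := fun _ => rfl }

theorem parity_swap (p : Square n m) : parity p.swap = parity p := by
  simp only [parity, Prod.fst_swap, Prod.snd_swap, Nat.add_comm]

/-- Any two squares that can be interchanged by rotations are linked. -/
def Conn (b n m : ℕ) : Prop :=
  ∀ p q : Square n m, (b % 2 = 0 ∨ parity p = parity q) → Linked (rotGroup b n m) p q

theorem Conn.transpose (h : Conn b n m) : Conn b m n := by
  intro p q hpq
  have h1 := h p.swap q.swap (by rwa [parity_swap, parity_swap])
  refine h1.map (transposeHom n m) Prod.swap Prod.swap_injective ?_ (map_transposeHom_le b n m)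
  intro x y z
  have hsw : ∀ x y : Square n m, transposeHom n m (swap x y) = swap x.swap y.swap := by
    intro x y
    ext1 p
    rw [transposeHom_apply, swap_apply_def, swap_apply_def]
    simp only [Prod.swap_eq_iff_eq_swap]
    split_ifs <;> simp
  rw [cycle3, map_mul, hsw, hsw]
  rfl

/-- The wider board is the union of two shifted copies of the smaller one. Column 1 belongs to both
as `2 ≤ m`, and contains both colours as `2 ≤ n`, so any chain can be routed through it. -/
theorem Conn.succ_right (hn : 2 ≤ n) (hm : 2 ≤ m) (h : Conn b n m) : Conn b n (m + 1) := by
  have left : ∀ p q : Square n (m + 1), p.2.val < m → q.2.val < m →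
      (b % 2 = 0 ∨ parity p = parity q) → Linked (rotGroup b n (m + 1)) p q := by
    rintro ⟨p1, p2⟩ ⟨q1, q2⟩ hp hq hpq
    have h1 := (h (p1, ⟨p2, hp⟩) (q1, ⟨q2, hq⟩) hpq).boardEmb (r := 0) (s := 0) (n := n)
      (m := m + 1) (by omega) (by omega)
    convert h1 using 1 <;> apply coords_injective <;> rw [coords_boardEmb] <;> simp [coords]
  have right : ∀ p q : Square n (m + 1), 1 ≤ p.2.val → 1 ≤ q.2.val →
      (b % 2 = 0 ∨ parity p = parity q) → Linked (rotGroup b n (m + 1)) p q := by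
    rintro ⟨p1, p2⟩ ⟨q1, q2⟩ hp hq hpq
    simp only at hp hq
    have h1 := (h (p1, ⟨p2 - 1, by omega⟩) (q1, ⟨q2 - 1, by omega⟩)
      (by simp only [parity] at hpq ⊢; omega)).boardEmb (r := 0) (s := 1) (n := n)
      (m := m + 1) (by omega) (by omega)
    convert h1 using 1 <;> apply coords_injective <;> rw [coords_boardEmb] <;>
      simp only [coords, Prod.mk.injEq] <;> omega
  have mid : ∀ p : Square n (m + 1), ∃ w : Square n (m + 1), w.2.val = 1 ∧
      parity p = parity w := by
    rintro ⟨p1, p2⟩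
    refine ⟨(⟨(p1.val + p2.val + 1) % 2, by omega⟩, ⟨1, by omega⟩), rfl, ?_⟩
    simp only [parity]
    omega
  intro p q hpq
  obtain ⟨w, hw, hpw⟩ := mid p
  have h1 : Linked (rotGroup b n (m + 1)) p w := by
    by_cases hp : p.2.val < m
    · exact left _ _ hp (by omega) (Or.inr hpw)
    · exact right _ _ (by omega) (by omega) (Or.inr hpw)
  have hwq : b % 2 = 0 ∨ parity w = parity q := by rwa [← hpw]
  refine h1.trans ?_
  by_cases hq : q.2.val < m
  · exact left _ _ (by omega) hq hwq
  · exact right _ _ (by omega) (by omega) hwq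

theorem Conn.mono_right {m' : ℕ} (hn : 2 ≤ n) (hm : 2 ≤ m) (h : Conn b n m) (hmm : m ≤ m') :
    Conn b n m' := by
  induction m', hmm using Nat.le_induction with
  | base => exact h
  | succ k hk ih => exact ih.succ_right hn (hm.trans hk)

theorem Conn.mono {n' m' : ℕ} (hn : 2 ≤ n) (hm : 2 ≤ m) (h : Conn b n m) (hnn : n ≤ n')
    (hmm : m ≤ m') : Conn b n' m' :=
  ((h.mono_right hn hm hmm).transpose.mono_right (hm.trans hmm) hn hnn).transpose

end Rotations

/-! ### The `b × (b + 1)` board for `b ≥ 5` -/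

section Window

theorem perm_apply_inv {α : Type*} (σ : Perm α) (x : α) : σ (σ⁻¹ x) = x := by
  rw [← Perm.mul_apply, mul_inv_cancel, Perm.one_apply]

theorem perm_inv_apply {α : Type*} (σ : Perm α) (x : α) : σ⁻¹ (σ x) = x := by
  rw [← Perm.mul_apply, inv_mul_cancel, Perm.one_apply]

/-- The left `b × b` block of the `b × (b + 1)` board. -/
def leftRot (b : ℕ) : Perm (Square b (b + 1)) :=
  blockRot (b := b) (r := 0) (s := 0) (by omega) (by omega)

/-- The right `b × b` block of the `b × (b + 1)` board. -/
def rightRot (b : ℕ) : Perm (Square b (b + 1)) :=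
  blockRot (b := b) (r := 0) (s := 1) (by omega) (by omega)

theorem leftRot_mem (b : ℕ) : leftRot b ∈ rotGroup b b (b + 1) := blockRot_mem _ _

theorem rightRot_mem (b : ℕ) : rightRot b ∈ rotGroup b b (b + 1) := blockRot_mem _ _

theorem coords_lt {b : ℕ} (p : Square b (b + 1)) : (coords p).1 < b ∧ (coords p).2 ≤ b :=
  ⟨p.1.isLt, Nat.lt_succ_iff.mp p.2.isLt⟩

variable {b : ℕ}

theorem coords_leftRot (p : Square b (b + 1)) :
    coords (leftRot b p) =
      if (coords p).2 < b then (b - 1 - (coords p).2, (coords p).1) else coords p := by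
  have h := coords_lt p
  rw [leftRot, coords_blockRot, rotFun]
  by_cases h2 : (coords p).2 < b
  · rw [if_pos h2, if_pos (by omega)]
    ext <;> simp
  · rw [if_neg h2, if_neg (by omega)]

theorem coords_rightRot (p : Square b (b + 1)) :
    coords (rightRot b p) =
      if 0 < (coords p).2 then (b - (coords p).2, (coords p).1 + 1) else coords p := by
  have h := coords_lt p
  rw [rightRot, coords_blockRot, rotFun]
  by_cases h2 : 0 < (coords p).2
  · rw [if_pos h2, if_pos (by omega)]
    ext <;> simp only <;> omega
  · rw [if_neg h2, if_neg (by omega)]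

theorem coords_leftRot_inv (p : Square b (b + 1)) :
    coords ((leftRot b)⁻¹ p) =
      if (coords p).2 < b then ((coords p).2, b - 1 - (coords p).1) else coords p := by
  have h := coords_lt p
  rw [leftRot, coords_blockRot_inv, rotFunInv]
  by_cases h2 : (coords p).2 < b
  · rw [if_pos h2, if_pos (by omega)]
    ext <;> simp
  · rw [if_neg h2, if_neg (by omega)]

theorem coords_rightRot_inv (p : Square b (b + 1)) :
    coords ((rightRot b)⁻¹ p) =
      if 0 < (coords p).2 then ((coords p).2 - 1, b - (coords p).1) else coords p := by
  have h := coords_lt p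
  rw [rightRot, coords_blockRot_inv, rotFunInv]
  by_cases h2 : 0 < (coords p).2
  · rw [if_pos h2, if_pos (by omega)]
    ext <;> simp only <;> omega
  · rw [if_neg h2, if_neg (by omega)]

/-- A set of squares of the `b × (b + 1)` board that is stable under both rotations contains, with
a square, all squares of the same colour, and all squares if `b` is even. -/
theorem mem_of_stable {S : Set (Square b (b + 1))} (hb : 2 ≤ b)
    (hL : ∀ p, leftRot b p ∈ S ↔ p ∈ S) (hR : ∀ p, rightRot b p ∈ S ↔ p ∈ S)
    {p q : Square b (b + 1)} (hpq : b % 2 = 0 ∨ parity p = parity q) (hp : p ∈ S) : q ∈ S := by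
  have hL' : ∀ p, (leftRot b)⁻¹ p ∈ S ↔ p ∈ S := fun p => by rw [← hL, perm_apply_inv]
  have hR' : ∀ p, (rightRot b)⁻¹ p ∈ S ↔ p ∈ S := fun p => by rw [← hR, perm_apply_inv]
  -- Two opposite quarter turns about different centres compose to a translation: one order of
  -- senses gives a diagonal step down-right, the other a step up-right.
  have down : ∀ p q : Square b (b + 1), (coords q).1 = (coords p).1 + 1 →
      (coords q).2 = (coords p).2 + 1 → (q ∈ S ↔ p ∈ S) := by
    intro p q h1 h2
    have hq := coords_lt q
    have : rightRot b ((leftRot b)⁻¹ p) = q := by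
      apply coords_injective
      rw [coords_rightRot, coords_leftRot_inv,
        if_pos (show (coords p).2 < b by omega), if_pos (by simp only; omega)]
      ext <;> simp only <;> omega
    rw [← this, hR, hL']
  have up : ∀ p q : Square b (b + 1), (coords p).1 = (coords q).1 + 1 →
      (coords q).2 = (coords p).2 + 1 → (q ∈ S ↔ p ∈ S) := by
    intro p q h1 h2
    have hq := coords_lt q
    have hp := coords_lt p
    have : (rightRot b)⁻¹ (leftRot b p) = q := by
      apply coords_injective
      rw [coords_rightRot_inv, coords_leftRot,
        if_pos (show (coords p).2 < b by omega), if_pos (by simp only; omega)]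
      ext <;> simp only <;> omega
    rw [← this, hR', hL]
  have mk : ∀ i j, i < b → j ≤ b → ∃ w : Square b (b + 1), coords w = (i, j) := fun i j hi hj =>
    ⟨(⟨i, hi⟩, ⟨j, by omega⟩), rfl⟩
  -- Diagonal steps lower the coordinate sum `k` by 2 until one of the first two squares of the top
  -- row is reached. On the first row or column one goes around through a neighbouring diagonal.
  have top : ∀ k, ∀ p q : Square b (b + 1), (coords p).1 + (coords p).2 = k →
      coords q = (0, k % 2) → (q ∈ S ↔ p ∈ S) := by
    intro k
    induction k using Nat.strong_induction_on with
    | _ k ih =>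
      intro p q hk hq
      have hp := coords_lt p
      by_cases h0 : (coords p).1 = 0
      · by_cases h1 : (coords p).2 < 2
        · rw [show q = p from coords_injective (by rw [hq]; ext <;> simp only <;> omega)]
        · obtain ⟨w, hw⟩ := mk 1 ((coords p).2 - 1) (by omega) (by omega)
          obtain ⟨v, hv⟩ := mk 0 ((coords p).2 - 2) (by omega) (by omega)
          rw [up w p (by simp only [hw]; omega) (by simp only [hw]; omega),
            down v w (by simp only [hw, hv]) (by simp only [hw, hv]; omega)]
          exact ih (k - 2) (by omega) v q (by simp only [hv]; omega)
            (by rw [hq]; ext <;> simp only <;> omega)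
      · by_cases h1 : (coords p).2 = 0
        · obtain ⟨w, hw⟩ := mk ((coords p).1 - 1) 1 (by omega) (by omega)
          rw [← up p w (by simp only [hw]; omega) (by simp only [hw]; omega)]
          by_cases h2 : (coords p).1 = 1
          · rw [show q = w from coords_injective (by rw [hq, hw]; ext <;> simp only <;> omega)]
          · obtain ⟨v, hv⟩ := mk ((coords p).1 - 2) 0 (by omega) (by omega)
            rw [down v w (by simp only [hw, hv]; omega) (by simp only [hw, hv])]
            exact ih (k - 2) (by omega) v q (by simp only [hv]; omega)
              (by rw [hq]; ext <;> simp only <;> omega)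
        · obtain ⟨v, hv⟩ := mk ((coords p).1 - 1) ((coords p).2 - 1) (by omega) (by omega)
          rw [down v p (by simp only [hv]; omega) (by simp only [hv]; omega)]
          exact ih (k - 2) (by omega) v q (by simp only [hv]; omega)
            (by rw [hq]; ext <;> simp only <;> omega)
  obtain ⟨u, hu⟩ := mk 0 (((coords p).1 + (coords p).2) % 2) (by omega) (by omega)
  obtain ⟨v, hv⟩ := mk 0 (((coords q).1 + (coords q).2) % 2) (by omega) (by omega)
  have h1 : u ∈ S := (top _ p u rfl hu).mpr hp
  suffices h2 : v ∈ S from (top _ q v rfl hv).mp h2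
  by_cases h : ((coords p).1 + (coords p).2) % 2 = ((coords q).1 + (coords q).2) % 2
  · rwa [show v = u from coords_injective (by rw [hu, hv, h])]
  · have hb2 : b % 2 = 0 := by
      rcases hpq with h' | h'
      · exact h'
      · exact absurd h' h
    -- For even `b` the left rotation changes the colour of this square, which joins the two
    -- colours.
    have hu' := (hL u).mpr h1
    have e : coords (leftRot b u) = (b - 1 - ((coords p).1 + (coords p).2) % 2, 0) := by
      rw [coords_leftRot, hu, if_pos (by simp only; omega)]
    exact (top _ _ v rfl (by
      rw [hv, e]
      ext <;> simp only <;> omega)).mpr hu'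

/-- On the `b × (b + 1)` board, a 3-cycle through squares of the first and the last column links
all squares of the same colour. -/
theorem linked_of_columns (hb : 2 ≤ b) {x y p : Square b (b + 1)}
    (hxy : Linked (rotGroup b b (b + 1)) x y) (hx : (coords x).2 = 0) (hy : (coords y).2 = b)
    (hp : b % 2 = 0 ∨ parity x = parity p) : Linked (rotGroup b b (b + 1)) x p := by
  -- The right block misses the first column and the left block misses the last one. Each rotation
  -- thus fixes a square of the class of `x`, so the class is stable under both.
  have hRx : rightRot b x = x := coords_injective (by rw [coords_rightRot, if_neg (by omega)])
  have hLy : leftRot b y = y := coords_injective (by rw [coords_leftRot, if_neg (by omega)])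
  refine mem_of_stable (S := {p | Linked (rotGroup b b (b + 1)) x p}) hb (fun q => ?_)
    (fun q => ?_) hp (Linked.refl x)
  · refine ⟨fun h => ?_, fun h => Linked.apply_of_fixed (leftRot_mem b) hxy hLy h⟩
    have h1 := Linked.apply_of_fixed (inv_mem (leftRot_mem b)) hxy
      (by rw [Perm.inv_eq_iff_eq, hLy]) h
    rwa [perm_inv_apply] at h1
  · refine ⟨fun h => ?_, fun h => Linked.apply_of_fixed (rightRot_mem b) (Linked.refl x) hRx h⟩
    have h1 := Linked.apply_of_fixed (inv_mem (rightRot_mem b)) (Linked.refl x)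
      (by rw [Perm.inv_eq_iff_eq, hRx]) h
    rwa [perm_inv_apply] at h1

/-- A permutation moving only squares in the first column, the last column and the last row. -/
def edgeShift (b : ℕ) : Perm (Square b (b + 1)) := leftRot b * rightRot b * leftRot b * rightRot b

theorem edgeShift_mem (b : ℕ) : edgeShift b ∈ rotGroup b b (b + 1) :=
  mul_mem (mul_mem (mul_mem (leftRot_mem b) (rightRot_mem b)) (leftRot_mem b)) (rightRot_mem b)

/-- Where both quarter turns act, they compose to the half turn `(i, j) ↦ (b - 2 - i, b - j)`. Doing
this twice gives the identity. -/
theorem edgeShift_fixed {p : Square b (b + 1)} (h0 : 0 < (coords p).2) (h1 : (coords p).2 < b)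
    (h2 : (coords p).1 + 1 < b) : edgeShift b p = p := by
  apply coords_injective
  simp only [edgeShift, Perm.mul_apply, coords_leftRot, coords_rightRot]
  generalize coords p = q at *
  obtain ⟨i, j⟩ := q
  simp only at h0 h1 h2
  rw [if_pos h0]
  simp only
  rw [if_pos (show i + 1 < b from h2)]
  simp only
  rw [if_pos (show 0 < b - j by omega)]
  simp only
  rw [if_pos (show b - 1 - (i + 1) + 1 < b by omega)]
  ext <;> simp only <;> omega

theorem coords_edgeShift_of_moved {p : Square b (b + 1)} (h : edgeShift b p ≠ p) :
    (coords p).2 = 0 ∨ (coords p).2 = b ∨ (coords p).1 + 1 = b := by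
  have hp := coords_lt p
  by_contra hc
  exact h (edgeShift_fixed (by omega) (by omega) (by omega))

/-- Here and in the next three lemmas a rotation is described by linear relations without
subtraction, so that `omega` can follow a square through a whole word. -/
theorem leftRot_cases (p : Square b (b + 1)) :
    ((coords p).2 < b ∧ (coords (leftRot b p)).1 + (coords p).2 + 1 = b ∧
      (coords (leftRot b p)).2 = (coords p).1) ∨
    ((coords p).2 = b ∧ (coords (leftRot b p)).1 = (coords p).1 ∧
      (coords (leftRot b p)).2 = b) := by
  have hp := coords_lt p
  have h := coords_leftRot p
  split_ifs at h with hc <;> rw [Prod.ext_iff] at h <;> (try simp only at h) <;> omega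

theorem rightRot_cases (p : Square b (b + 1)) :
    (0 < (coords p).2 ∧ (coords (rightRot b p)).1 + (coords p).2 = b ∧
      (coords (rightRot b p)).2 = (coords p).1 + 1) ∨
    ((coords p).2 = 0 ∧ (coords (rightRot b p)).1 = (coords p).1 ∧
      (coords (rightRot b p)).2 = 0) := by
  have hp := coords_lt p
  have h := coords_rightRot p
  split_ifs at h with hc <;> rw [Prod.ext_iff] at h <;> (try simp only at h) <;> omega

theorem leftRot_inv_cases (p : Square b (b + 1)) :
    ((coords p).2 < b ∧ (coords ((leftRot b)⁻¹ p)).1 = (coords p).2 ∧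
      (coords ((leftRot b)⁻¹ p)).2 + (coords p).1 + 1 = b) ∨
    ((coords p).2 = b ∧ (coords ((leftRot b)⁻¹ p)).1 = (coords p).1 ∧
      (coords ((leftRot b)⁻¹ p)).2 = b) := by
  have hp := coords_lt p
  have h := coords_leftRot_inv p
  split_ifs at h with hc <;> rw [Prod.ext_iff] at h <;> (try simp only at h) <;> omega

theorem rightRot_inv_cases (p : Square b (b + 1)) :
    (0 < (coords p).2 ∧ (coords ((rightRot b)⁻¹ p)).1 + 1 = (coords p).2 ∧
      (coords ((rightRot b)⁻¹ p)).2 + (coords p).1 = b) ∨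
    ((coords p).2 = 0 ∧ (coords ((rightRot b)⁻¹ p)).1 = (coords p).1 ∧
      (coords ((rightRot b)⁻¹ p)).2 = 0) := by
  have hp := coords_lt p
  have h := coords_rightRot_inv p
  split_ifs at h with hc <;> rw [Prod.ext_iff] at h <;> (try simp only at h) <;> omega

theorem edgeShift_corner (hb : 3 ≤ b) {x : Square b (b + 1)} (hx : coords x = (b - 1, 0)) :
    coords (edgeShift b x) = (1, b) := by
  simp only [Prod.ext_iff] at hx ⊢
  simp only [edgeShift, Perm.mul_apply]
  have h1 := rightRot_cases x
  generalize rightRot b x = x1 at *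
  have h2 := leftRot_cases x1
  generalize leftRot b x1 = x2 at *
  have h3 := rightRot_cases x2
  generalize rightRot b x2 = x3 at *
  have h4 := leftRot_cases x3
  omega

theorem edgeShift_last_column (hb : 4 ≤ b) {x : Square b (b + 1)} (hx : coords x = (1, b)) :
    coords (edgeShift b x) = (b - 1, b - 3) := by
  simp only [Prod.ext_iff] at hx ⊢
  simp only [edgeShift, Perm.mul_apply]
  have h1 := rightRot_cases x
  generalize rightRot b x = x1 at *
  have h2 := leftRot_cases x1
  generalize leftRot b x1 = x2 at *
  have h3 := rightRot_cases x2
  generalize rightRot b x2 = x3 at *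
  have h4 := leftRot_cases x3
  omega

theorem edgeShift_first_column (hb : 3 ≤ b) {x : Square b (b + 1)} (hx : coords x = (1, 0)) :
    coords (edgeShift b x) = (b - 1, b) := by
  simp only [Prod.ext_iff] at hx ⊢
  simp only [edgeShift, Perm.mul_apply]
  have h1 := rightRot_cases x
  generalize rightRot b x = x1 at *
  have h2 := leftRot_cases x1
  generalize leftRot b x1 = x2 at *
  have h3 := rightRot_cases x2
  generalize rightRot b x2 = x3 at *
  have h4 := leftRot_cases x3
  omega

theorem edgeShift_last_corner (hb : 3 ≤ b) {x : Square b (b + 1)} (hx : coords x = (b - 1, b)) :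
    coords (edgeShift b x) = (b - 2, 0) := by
  simp only [Prod.ext_iff] at hx ⊢
  simp only [edgeShift, Perm.mul_apply]
  have h1 := rightRot_cases x
  generalize rightRot b x = x1 at *
  have h2 := leftRot_cases x1
  generalize leftRot b x1 = x2 at *
  have h3 := rightRot_cases x2
  generalize rightRot b x2 = x3 at *
  have h4 := leftRot_cases x3
  omega

/-- If the conjugate of the edge permutation by `g` moves only one square `x` of the edge, and `x`
is as in `linked_of_columns`, then the colour class of `x` is linked. -/
theorem linked_of_conj_edgeShift (hb : 2 ≤ b) {g : Perm (Square b (b + 1))}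
    (hg : g ∈ rotGroup b b (b + 1)) {x p : Square b (b + 1)} (h0 : (coords x).2 = 0)
    (h1 : (coords (edgeShift b x)).2 = b) (h2 : edgeShift b (g⁻¹ x) ≠ g⁻¹ x)
    (h3 : ∀ q : Square b (b + 1), edgeShift b q ≠ q → edgeShift b (g⁻¹ q) ≠ g⁻¹ q → q = x)
    (hp : b % 2 = 0 ∨ parity x = parity p) : Linked (rotGroup b b (b + 1)) x p := by
  have hE : edgeShift b x ≠ x := by
    intro hc
    rw [hc] at h1
    omega
  have hmoved : ∀ q, (g * edgeShift b * g⁻¹) q ≠ q → edgeShift b (g⁻¹ q) ≠ g⁻¹ q := by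
    intro q hq hc
    apply hq
    rw [Perm.mul_apply, Perm.mul_apply, hc, perm_apply_inv]
  have hF : (g * edgeShift b * g⁻¹) x ≠ x := by
    intro hc
    apply h2
    rw [Perm.mul_apply, Perm.mul_apply] at hc
    rw [eq_comm, Perm.inv_eq_iff_eq, hc]
  have hcom := commutator_eq_cycle3 hE hF fun q hq hq' => h3 q hq (hmoved q hq')
  have hEm := edgeShift_mem b
  have hFm := mul_mem (mul_mem hg hEm) (inv_mem hg)
  -- A common image of `x` would be a second square moved by both permutations.
  have hEF : edgeShift b x ≠ (g * edgeShift b * g⁻¹) x := by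
    intro hc
    have hx : edgeShift b (edgeShift b x) ≠ edgeShift b x := (edgeShift b).injective.ne hE
    refine hE (h3 _ hx (hmoved _ ?_))
    rw [hc]
    exact (g * edgeShift b * g⁻¹).injective.ne hF
  have hmem : cycle3 x (edgeShift b x) ((g * edgeShift b * g⁻¹) x) ∈ rotGroup b b (b + 1) := by
    rw [← hcom]
    exact mul_mem (mul_mem (mul_mem hEm hFm) (inv_mem hEm)) (inv_mem hFm)
  exact linked_of_columns hb (linked_of_cycle3_mem hE.symm hEF hF.symm hmem).1 h0 h1 hp

/-- The conjugating word takes the three edges to a set that meets them only in the corner `(b - 1,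
0)`. It takes `(1, b)` to this corner, and `edgeShift` takes the corner to `(1, b)`, in the last
column. -/
theorem linked_of_corner (hb : 5 ≤ b) {x p : Square b (b + 1)} (hx : coords x = (b - 1, 0))
    (hp : b % 2 = 0 ∨ parity x = parity p) : Linked (rotGroup b b (b + 1)) x p := by
  have hL := leftRot_mem b
  have hR := rightRot_mem b
  have track : ∀ q : Square b (b + 1), ∃ w,
      (rightRot b * leftRot b * (rightRot b)⁻¹ * (leftRot b)⁻¹ * (leftRot b)⁻¹ *
        (rightRot b)⁻¹)⁻¹ q = w ∧ (q = x → coords w = (1, b)) ∧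
      ((coords q).2 = 0 ∨ (coords q).2 = b ∨ (coords q).1 + 1 = b →
       (coords w).2 = 0 ∨ (coords w).2 = b ∨ (coords w).1 + 1 = b → coords q = (b - 1, 0)) := by
    intro q
    refine ⟨_, rfl, ?_⟩
    simp only [mul_inv_rev, inv_inv, Perm.mul_apply]
    have hq := coords_lt q
    have hqx : q = x → (coords q).1 = b - 1 ∧ (coords q).2 = 0 := by
      rintro rfl
      rw [hx]
      exact ⟨rfl, rfl⟩
    simp only [Prod.ext_iff (α := ℕ) (β := ℕ)]
    have h1 := rightRot_inv_cases q
    generalize (rightRot b)⁻¹ q = q1 at *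
    have h2 := leftRot_inv_cases q1
    generalize (leftRot b)⁻¹ q1 = q2 at *
    have h3 := rightRot_cases q2
    generalize rightRot b q2 = q3 at *
    have h4 := leftRot_cases q3
    generalize leftRot b q3 = q4 at *
    have h5 := leftRot_cases q4
    generalize leftRot b q4 = q5 at *
    have h6 := rightRot_cases q5
    generalize rightRot b q5 = q6 at *
    refine ⟨fun hc => ?_, fun hc hc' => ?_⟩
    · have := hqx hc
      omega
    · clear hqx
      rcases hc with hc | hc | hc <;> rcases h1 with h1 | h1 <;> rcases h2 with h2 | h2 <;>
        rcases h3 with h3 | h3 <;> try omega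
  refine linked_of_conj_edgeShift (by omega)
    (g := rightRot b * leftRot b * (rightRot b)⁻¹ * (leftRot b)⁻¹ * (leftRot b)⁻¹ * (rightRot b)⁻¹)
    (mul_mem (mul_mem (mul_mem (mul_mem (mul_mem hR hL) (inv_mem hR)) (inv_mem hL)) (inv_mem hL))
      (inv_mem hR)) (by rw [hx]) (by rw [edgeShift_corner (by omega) hx]) ?_ ?_ hp
  · obtain ⟨w, hw, hw', -⟩ := track x
    rw [hw]
    intro hc
    have := edgeShift_last_column (by omega) (hw' rfl)
    rw [hc, hw' rfl, Prod.mk.injEq] at this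
    omega
  · intro q h1 h2
    obtain ⟨w, hw, -, hw'⟩ := track q
    rw [hw] at h2
    exact coords_injective ((hw' (coords_edgeShift_of_moved h1)
      (coords_edgeShift_of_moved h2)).trans hx.symm)

/-- The same argument with a word for which the common square is `(1, 0)`. For odd `b` this square
has the colour opposite to that of the corner `(b - 1, 0)`. -/
theorem linked_of_second_row (hb : 5 ≤ b) {x p : Square b (b + 1)} (hx : coords x = (1, 0))
    (hp : b % 2 = 0 ∨ parity x = parity p) : Linked (rotGroup b b (b + 1)) x p := by
  have hL := leftRot_mem b
  have hR := rightRot_mem b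
  have track : ∀ q : Square b (b + 1), ∃ w,
      ((leftRot b)⁻¹ * (rightRot b)⁻¹ * (rightRot b)⁻¹ * (leftRot b)⁻¹ * rightRot b *
        leftRot b)⁻¹ q = w ∧ (q = x → coords w = (b - 1, b)) ∧
      ((coords q).2 = 0 ∨ (coords q).2 = b ∨ (coords q).1 + 1 = b →
       (coords w).2 = 0 ∨ (coords w).2 = b ∨ (coords w).1 + 1 = b → coords q = (1, 0)) := by
    intro q
    refine ⟨_, rfl, ?_⟩
    simp only [mul_inv_rev, inv_inv, Perm.mul_apply]
    have hq := coords_lt q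
    have hqx : q = x → (coords q).1 = 1 ∧ (coords q).2 = 0 := by
      rintro rfl
      rw [hx]
      exact ⟨rfl, rfl⟩
    simp only [Prod.ext_iff (α := ℕ) (β := ℕ)]
    have h1 := leftRot_cases q
    generalize leftRot b q = q1 at *
    have h2 := rightRot_cases q1
    generalize rightRot b q1 = q2 at *
    have h3 := rightRot_cases q2
    generalize rightRot b q2 = q3 at *
    have h4 := leftRot_cases q3
    generalize leftRot b q3 = q4 at *
    have h5 := rightRot_inv_cases q4
    generalize (rightRot b)⁻¹ q4 = q5 at *
    have h6 := leftRot_inv_cases q5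
    generalize (leftRot b)⁻¹ q5 = q6 at *
    refine ⟨fun hc => ?_, fun hc hc' => ?_⟩
    · have := hqx hc
      omega
    · clear hqx
      rcases hc with hc | hc | hc <;> rcases h1 with h1 | h1 <;> rcases h2 with h2 | h2 <;>
        rcases h3 with h3 | h3 <;> try omega
  refine linked_of_conj_edgeShift (by omega)
    (g := (leftRot b)⁻¹ * (rightRot b)⁻¹ * (rightRot b)⁻¹ * (leftRot b)⁻¹ * rightRot b * leftRot b)
    (mul_mem (mul_mem (mul_mem (mul_mem (mul_mem (inv_mem hL) (inv_mem hR)) (inv_mem hR))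
      (inv_mem hL)) hR) hL) (by rw [hx]) (by rw [edgeShift_first_column (by omega) hx]) ?_ ?_ hp
  · obtain ⟨w, hw, hw', -⟩ := track x
    rw [hw]
    intro hc
    have := edgeShift_last_corner (by omega) (hw' rfl)
    rw [hc, hw' rfl, Prod.mk.injEq] at this
    omega
  · intro q h1 h2
    obtain ⟨w, hw, -, hw'⟩ := track q
    rw [hw] at h2
    exact coords_injective ((hw' (coords_edgeShift_of_moved h1)
      (coords_edgeShift_of_moved h2)).trans hx.symm)

theorem conn_of_five_le (hb : 5 ≤ b) : Conn b b (b + 1) := by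
  intro p q hpq
  have hx : coords ((⟨b - 1, by omega⟩, ⟨0, by omega⟩) : Square b (b + 1)) = (b - 1, 0) := rfl
  have hy : coords ((⟨1, by omega⟩, ⟨0, by omega⟩) : Square b (b + 1)) = (1, 0) := rfl
  by_cases h : b % 2 = 0 ∨ parity p = 0
  · have hp := linked_of_corner (p := p) hb hx (by simp only [parity] at h ⊢; omega)
    have hq := linked_of_corner (p := q) hb hx (by simp only [parity] at h hpq ⊢; omega)
    exact hp.symm.trans hq
  · have hp := linked_of_second_row (p := p) hb hy (by simp only [parity] at h ⊢; omega)
    have hq := linked_of_second_row (p := q) hb hy (by simp only [parity] at h hpq ⊢; omega)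
    exact hp.symm.trans hq

end Window

/-! ### Explicit 3-cycles on the small boards for `b = 2, 3, 4` -/

section SmallBoards

variable {b n m : ℕ}

theorem linked_of_grow {gs : List (Perm (Square n m))} (hgs : ∀ g ∈ gs, g ∈ rotGroup b n m)
    {w : Perm (Square n m)} (hw : w ∈ rotGroup b n m) {x y z : Square n m}
    (hwc : w = cycle3 x y z) (hxy : x ≠ y) (hyz : y ≠ z) (hxz : x ≠ z) (k : ℕ)
    {P : Square n m → Prop}
    (hall : ∀ p, P p → p ∈ (fun T => gs.foldr grow T)^[k] ({x, y, z} : Finset (Square n m)))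
    (p : Square n m) (hp : P p) : Linked (rotGroup b n m) x p := by
  obtain ⟨h1, h2⟩ := linked_of_cycle3_mem hxy hyz hxz (hwc ▸ hw)
  refine linked_iterate_grow hgs (fun q hq => ?_) k p (hall p hp)
  simp only [Finset.mem_insert, Finset.mem_singleton] at hq
  rcases hq with rfl | rfl | rfl
  · exact Linked.refl _
  · exact h1
  · exact h2

theorem conn_of_linked (x : Square n m)
    (h : ∀ p, True → Linked (rotGroup b n m) x p) : Conn b n m :=
  fun p q _ => (h p trivial).symm.trans (h q trivial)

theorem conn_of_linked_odd (hb : b % 2 = 1) (x y : Square n m)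
    (h0 : ∀ p, parity p = 0 → Linked (rotGroup b n m) x p)
    (h1 : ∀ p, parity p = 1 → Linked (rotGroup b n m) y p) : Conn b n m := by
  intro p q hpq
  have hpq : parity p = parity q := by omega
  rcases Nat.mod_two_eq_zero_or_one (p.1.val + p.2.val) with h | h
  · exact (h0 p h).symm.trans (h0 q (hpq ▸ h))
  · exact (h1 p h).symm.trans (h1 q (hpq ▸ h))

/-- The rotation of the block at `(r, s)`, if this block lies on the board. -/
def rotAt (b n m r s : ℕ) : Perm (Square n m) :=
  if h : r + b ≤ n ∧ s + b ≤ m then blockRot h.1 h.2 else 1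

theorem rotAt_mem (b n m r s : ℕ) : rotAt b n m r s ∈ rotGroup b n m := by
  rw [rotAt]
  split_ifs
  · exact blockRot_mem _ _
  · exact one_mem _

/-- The rotations of the blocks with the given positions, taken clockwise where the sign is
negative, multiplied from left to right. -/
def rotWord (b n m : ℕ) (l : List (ℕ × ℕ × Bool)) : Perm (Square n m) :=
  (l.map fun t => if t.2.2 then rotAt b n m t.1 t.2.1 else (rotAt b n m t.1 t.2.1)⁻¹).prod

theorem rotWord_mem (b n m : ℕ) (l : List (ℕ × ℕ × Bool)) : rotWord b n m l ∈ rotGroup b n m := by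
  refine list_prod_mem fun g hg => ?_
  obtain ⟨t, -, rfl⟩ := List.mem_map.mp hg
  split_ifs
  · exact rotAt_mem _ _ _ _ _
  · exact inv_mem (rotAt_mem _ _ _ _ _)

theorem rotAt_list_mem (b n m : ℕ) (l : List (ℕ × ℕ)) :
    ∀ g ∈ l.map (fun t => rotAt b n m t.1 t.2), g ∈ rotGroup b n m := by
  intro g hg
  obtain ⟨t, -, rfl⟩ := List.mem_map.mp hg
  exact rotAt_mem _ _ _ _ _

/-- The word is the commutator of two rotations whose blocks share only the central square. -/
theorem conn_two_three_three : Conn 2 3 3 :=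
  conn_of_linked (0, 1)
    (linked_of_grow (rotAt_list_mem 2 3 3 [(0, 0), (0, 1), (1, 0), (1, 1)])
      (rotWord_mem 2 3 3 [(0, 0, true), (1, 1, true), (0, 0, false), (1, 1, false)])
      (y := (2, 1)) (z := (1, 1)) (by decide +kernel) (by decide) (by decide) (by decide) 8
      (by decide +kernel))

theorem conn_two_two_four : Conn 2 2 4 :=
  conn_of_linked (0, 3)
    (linked_of_grow (rotAt_list_mem 2 2 4 [(0, 0), (0, 1), (0, 2)])
      (rotWord_mem 2 2 4 [(0, 0, true), (0, 0, true), (0, 1, true), (0, 2, true), (0, 2, true), (0, 0, false), (0, 1, true), (0, 2, false)])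
      (y := (1, 0)) (z := (1, 1)) (by decide +kernel) (by decide) (by decide) (by decide) 8
      (by decide +kernel))

theorem conn_three_four_four : Conn 3 4 4 :=
  conn_of_linked_odd rfl (0, 2) (0, 1)
    (linked_of_grow (rotAt_list_mem 3 4 4 [(0, 0), (0, 1), (1, 0), (1, 1)])
      -- The power reduces the word to a single 3-cycle: the lengths of its other cycles divide the
      -- exponent. The same device is used below.
      (pow_mem (rotWord_mem 3 4 4 [(0, 0, true), (0, 1, true), (1, 1, false), (1, 0, false), (1, 1, true)]) 2)
      (y := (2, 2)) (z := (1, 1)) (by decide +kernel) (by decide) (by decide) (by decide) 8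
      (by decide +kernel))
    (linked_of_grow (rotAt_list_mem 3 4 4 [(0, 0), (0, 1), (1, 0), (1, 1)])
      (pow_mem (rotWord_mem 3 4 4 [(0, 0, true), (0, 1, true), (1, 0, true), (1, 1, false), (1, 0, false)]) 2)
      (y := (2, 3)) (z := (1, 2)) (by decide +kernel) (by decide) (by decide) (by decide) 8
      (by decide +kernel))

theorem conn_three_three_five : Conn 3 3 5 :=
  conn_of_linked_odd rfl (0, 0) (0, 1)
    (linked_of_grow (rotAt_list_mem 3 3 5 [(0, 0), (0, 1), (0, 2)])
      (pow_mem (rotWord_mem 3 3 5 [(0, 0, true), (0, 0, true), (0, 1, true), (0, 2, false), (0, 1, true), (0, 0, true), (0, 2, false)]) 2)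
      (y := (2, 4)) (z := (0, 2)) (by decide +kernel) (by decide) (by decide) (by decide) 8
      (by decide +kernel))
    (linked_of_grow (rotAt_list_mem 3 3 5 [(0, 0), (0, 1), (0, 2)])
      (pow_mem (rotWord_mem 3 3 5 [(0, 0, true), (0, 2, true), (0, 0, false), (0, 2, false)]) 2)
      (y := (1, 2)) (z := (2, 3)) (by decide +kernel) (by decide) (by decide) (by decide) 8
      (by decide +kernel))

theorem conn_four_four_five : Conn 4 4 5 :=
  conn_of_linked (0, 0)
    (linked_of_grow (rotAt_list_mem 4 4 5 [(0, 0), (0, 1)])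
      (pow_mem (rotWord_mem 4 4 5 [(0, 0, true), (0, 0, true), (0, 1, true), (0, 1, true), (0, 0, false), (0, 1, false), (0, 0, true), (0, 1, true), (0, 0, false), (0, 1, false)]) 4)
      (y := (2, 1)) (z := (0, 2)) (by decide +kernel) (by decide) (by decide) (by decide) 8
      (by decide +kernel))

/-- The remaining cases with two linked colour classes all contain one of the small boards. -/
theorem conn_of_two_le (hb : 2 ≤ b) (hn : b ≤ n) (hm : b ≤ m) (hne : ¬ (b = n ∧ n = m))
    (h2 : b = 2 → ¬ ((n = 2 ∧ m = 3) ∨ (n = 3 ∧ m = 2)))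
    (h3 : b = 3 → ¬ ((n = 3 ∧ m = 4) ∨ (n = 4 ∧ m = 3))) : Conn b n m := by
  rcases Nat.lt_or_ge b 4 with hb4 | hb4
  · obtain rfl | rfl : b = 2 ∨ b = 3 := by omega
    · by_cases h : 3 ≤ n ∧ 3 ≤ m
      · exact conn_two_three_three.mono (by omega) (by omega) h.1 h.2
      · rcases Nat.lt_or_ge m 4 with hm4 | hm4
        · exact conn_two_two_four.transpose.mono (by omega) (by omega) (by omega) (by omega)
        · exact conn_two_two_four.mono (by omega) (by omega) (by omega) (by omega)
    · by_cases h : 4 ≤ n ∧ 4 ≤ m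
      · exact conn_three_four_four.mono (by omega) (by omega) h.1 h.2
      · rcases Nat.lt_or_ge m 5 with hm5 | hm5
        · exact conn_three_three_five.transpose.mono (by omega) (by omega) (by omega) (by omega)
        · exact conn_three_three_five.mono (by omega) (by omega) (by omega) (by omega)
  · have h : Conn b b (b + 1) := by
      rcases Nat.lt_or_ge b 5 with hb5 | hb5
      · obtain rfl : b = 4 := by omega
        exact conn_four_four_five
      · exact conn_of_five_le hb5
    rcases Nat.lt_or_ge b m with hm' | hm'
    · exact h.mono hb (by omega) hn hm'
    · exact h.transpose.mono (by omega) hb (by omega) hm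

end SmallBoards

/-! ### Signs of block rotations, on the whole board and on each colour -/

section Signs

/-- The sign of a permutation all of whose nontrivial cycles have length `4`. -/
theorem sign_of_pow_four {α : Type*} [Fintype α] [DecidableEq α] {σ : Perm α} (h4 : σ ^ 4 = 1)
    (h2 : ∀ x, σ (σ x) = x → σ x = x) : Perm.sign σ = (-1) ^ (σ.support.card / 4) := by
  have hall : ∀ k ∈ σ.cycleType, k = 4 := by
    intro k hk
    have hdvd : k ∣ 4 := (Perm.dvd_of_mem_cycleType hk).trans (orderOf_dvd_of_pow_eq_one h4)
    have hge := Perm.two_le_of_mem_cycleType hk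
    have hle := Nat.le_of_dvd (by norm_num) hdvd
    have hk2 : k ≠ 2 := by
      rintro rfl
      rw [Perm.cycleType_def, Multiset.mem_map] at hk
      obtain ⟨c, hc, hcard⟩ := hk
      obtain ⟨hcyc, hcσ⟩ := Perm.mem_cycleFactorsFinset_iff.mp hc
      obtain ⟨x, hx⟩ := hcyc.nonempty_support
      have hx' : c x ∈ c.support := Perm.apply_mem_support.mpr hx
      have hsq : c ^ 2 = 1 := by
        rw [← pow_orderOf_eq_one c, hcyc.orderOf]
        exact congrArg (c ^ ·) hcard.symm
      have hcc : c (c x) = x := by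
        rw [← Perm.mul_apply, ← pow_two, hsq, Perm.one_apply]
      apply Perm.mem_support.mp hx
      rw [hcσ x hx]
      apply h2
      rw [← hcσ x hx, ← hcσ _ hx', hcc]
    interval_cases k <;> omega
  -- All nontrivial cycles have length 4 and are odd, so the sign counts them modulo 2.
  have hrep := Multiset.eq_replicate_card.mpr hall
  have hsum := Perm.sum_cycleType σ
  rw [hrep, Multiset.sum_replicate, smul_eq_mul] at hsum
  rw [Perm.sign_of_cycleType, Perm.sum_cycleType, ← hsum, Nat.mul_div_cancel _ (by norm_num),
    pow_add, mul_comm _ 4, pow_mul, show (-1 : ℤˣ) ^ 4 = 1 from rfl, one_pow, one_mul]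

variable {n m b r s : ℕ}

/-- The last condition excludes the centre. In doubled coordinates it is vacuous for even `b`, where
no square is the centre. -/
theorem blockRot_ne_self_iff (hr : r + b ≤ n) (hs : s + b ≤ m) (p : Square n m) :
    blockRot hr hs p ≠ p ↔ coords p ∈ Finset.Ico r (r + b) ×ˢ Finset.Ico s (s + b) ∧
      (2 * (coords p).1 + 1 = 2 * r + b → 2 * (coords p).2 + 1 ≠ 2 * s + b) := by
  rw [ne_eq, ← coords_injective.eq_iff, coords_blockRot]
  generalize coords p = q
  obtain ⟨i, j⟩ := q
  simp only [Finset.mem_product, Finset.mem_Ico]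
  by_cases h : (r ≤ i ∧ i < r + b) ∧ (s ≤ j ∧ j < s + b)
  · rw [rotFun_of_mem h, Prod.mk.injEq]
    omega
  · rw [show rotFun b r s (i, j) = (i, j) from if_neg h]
    simp [h]

/-- Inside the block a half turn fixes at most the central square, which the quarter turn fixes too.
This rules out 2-cycles. -/
theorem blockRot_eq_self_of_sq (hr : r + b ≤ n) (hs : s + b ≤ m) (p : Square n m)
    (h : blockRot hr hs (blockRot hr hs p) = p) : blockRot hr hs p = p := by
  rw [← coords_injective.eq_iff, coords_blockRot, coords_blockRot] at h
  rw [← coords_injective.eq_iff, coords_blockRot]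
  generalize coords p = q at *
  obtain ⟨i, j⟩ := q
  by_cases hb : (r ≤ i ∧ i < r + b) ∧ (s ≤ j ∧ j < s + b)
  · rw [rotFun_of_mem hb] at h ⊢
    rw [rotFun_of_mem (i := r + _) (by omega), Prod.mk.injEq] at h
    rw [Prod.mk.injEq]
    omega
  · exact if_neg hb

theorem image_coords_filter (P : ℕ × ℕ → Prop) [DecidablePred P]
    (h : ∀ q, P q → q.1 < n ∧ q.2 < m) (S : Finset (ℕ × ℕ)) (hS : ∀ q, q ∈ S ↔ P q) :
    (Finset.univ.filter fun p : Square n m => P (coords p)).card = S.card := by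
  rw [← Finset.card_image_of_injective _ coords_injective]
  congr 1
  ext ⟨i, j⟩
  simp only [Finset.mem_image, Finset.mem_filter, Finset.mem_univ, true_and, hS]
  constructor
  · rintro ⟨p, hp, he⟩
    rwa [← he]
  · intro hp
    exact ⟨(⟨i, (h _ hp).1⟩, ⟨j, (h _ hp).2⟩), hp, rfl⟩

theorem sign_blockRot_of_even (hr : r + b ≤ n) (hs : s + b ≤ m) (hb : b % 2 = 0) :
    Perm.sign (blockRot hr hs : Perm (Square n m)) = (-1) ^ (b * b / 4) := by
  rw [sign_of_pow_four (blockRot_pow_four hr hs) (blockRot_eq_self_of_sq hr hs)]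
  congr 2
  have h1 : (blockRot hr hs : Perm (Square n m)).support = Finset.univ.filter fun p =>
      coords p ∈ Finset.Ico r (r + b) ×ˢ Finset.Ico s (s + b) := by
    ext p
    rw [Perm.mem_support, blockRot_ne_self_iff, Finset.mem_filter]
    simp only [Finset.mem_univ, true_and, and_iff_left_iff_imp]
    omega
  rw [h1, image_coords_filter (n := n) (m := m)
    (fun q => q ∈ Finset.Ico r (r + b) ×ˢ Finset.Ico s (s + b)) _ _ (fun q => Iff.rfl)]
  · simp
  · rintro ⟨i, j⟩ h
    simp only [Finset.mem_product, Finset.mem_Ico] at h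
    simp only
    omega

theorem sum_Ico_neg_one_pow (r : ℕ) {b : ℕ} (hb : b % 2 = 1) :
    ∑ i ∈ Finset.Ico r (r + b), (-1 : ℤ) ^ i = (-1) ^ r := by
  obtain ⟨k, rfl⟩ : ∃ k, b = 2 * k + 1 := ⟨b / 2, by omega⟩
  induction k with
  | zero => simp
  | succ k ih =>
    rw [show r + (2 * (k + 1) + 1) = r + (2 * k + 1) + 1 + 1 by ring,
      Finset.sum_Ico_succ_top (by omega), Finset.sum_Ico_succ_top (by omega), ih (by omega)]
    ring

/-- A `b × b` block of odd size without its centre has as many squares of either colour. -/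
theorem card_block_colour (hb : b % 2 = 1) (q : ℕ) (hq : q < 2) :
    (((Finset.Ico r (r + b) ×ˢ Finset.Ico s (s + b)).erase (r + b / 2, s + b / 2)).filter
      fun p : ℕ × ℕ => (p.1 + p.2) % 2 = q).card = (b * b - 1) / 2 := by
  set S := (Finset.Ico r (r + b) ×ˢ Finset.Ico s (s + b)).erase (r + b / 2, s + b / 2) with hS
  have hmem : (r + b / 2, s + b / 2) ∈ Finset.Ico r (r + b) ×ˢ Finset.Ico s (s + b) := by
    simp only [Finset.mem_product, Finset.mem_Ico]
    omega
  have hcard : S.card = b * b - 1 := by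
    rw [hS, Finset.card_erase_of_mem hmem]
    simp
  -- The signed sum over the full block factors into rows and columns, giving `(-1) ^ r * (-1) ^ s`.
  -- This is exactly the contribution of the removed centre.
  have hsum : ∑ p ∈ S, (-1 : ℤ) ^ (p.1 + p.2) = 0 := by
    rw [hS, Finset.sum_erase_eq_sub hmem, Finset.sum_product]
    simp only [pow_add, ← Finset.mul_sum, ← Finset.sum_mul, sum_Ico_neg_one_pow _ hb]
    have : ((-1 : ℤ) ^ (b / 2)) * (-1) ^ (b / 2) = 1 := by
      rw [← mul_pow]
      norm_num
    linear_combination (-(-1) ^ r * (-1) ^ s) * this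
  have hsplit : ∑ p ∈ S, (-1 : ℤ) ^ (p.1 + p.2) =
      ((S.filter fun p => (p.1 + p.2) % 2 = 0).card : ℤ) -
        (S.filter fun p => ¬ (p.1 + p.2) % 2 = 0).card := by
    rw [← Finset.sum_filter_add_sum_filter_not S (fun p => (p.1 + p.2) % 2 = 0),
      Finset.sum_congr rfl (g := fun _ => (1 : ℤ)) (fun p hp => ?_),
      Finset.sum_congr (s₁ := S.filter fun p => ¬ (p.1 + p.2) % 2 = 0) rfl
        (g := fun _ => (-1 : ℤ)) (fun p hp => ?_)]
    · simp
      ring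
    · exact Odd.neg_one_pow (Nat.odd_iff.mpr (by have := (Finset.mem_filter.mp hp).2; omega))
    · exact Even.neg_one_pow (Nat.even_iff.mpr (Finset.mem_filter.mp hp).2)
  have hadd := Finset.card_filter_add_card_filter_not (s := S)
    (fun p : ℕ × ℕ => (p.1 + p.2) % 2 = 0)
  rw [hcard] at hadd
  have hodd : (S.filter fun p : ℕ × ℕ => ¬ (p.1 + p.2) % 2 = 0) =
      S.filter fun p => (p.1 + p.2) % 2 = 1 := by
    congr 1
    ext p
    omega
  rw [hodd] at hadd hsplit
  obtain rfl | rfl : q = 0 ∨ q = 1 := by omega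
  · omega
  · omega

theorem parity_blockRot (hr : r + b ≤ n) (hs : s + b ≤ m) (hb : b % 2 = 1) (p : Square n m) :
    parity (blockRot hr hs p) = parity p := by
  change ((coords (blockRot hr hs p)).1 + (coords (blockRot hr hs p)).2) % 2 =
    ((coords p).1 + (coords p).2) % 2
  rw [coords_blockRot]
  generalize coords p = q
  obtain ⟨i, j⟩ := q
  by_cases h : (r ≤ i ∧ i < r + b) ∧ (s ≤ j ∧ j < s + b)
  · rw [rotFun_of_mem h]
    simp only
    omega
  · rw [show rotFun b r s (i, j) = (i, j) from if_neg h]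

theorem sign_blockRot_subtypePerm (hr : r + b ≤ n) (hs : s + b ≤ m) (hb : b % 2 = 1) {q : ℕ}
    (hq : q < 2) (h : ∀ p : Square n m, parity (blockRot hr hs p) = q ↔ parity p = q) :
    Perm.sign (Perm.subtypePerm (p := fun p : Square n m => parity p = q) (blockRot hr hs) h) =
      (-1) ^ ((b * b - 1) / 8) := by
  rw [sign_of_pow_four]
  · rw [show (b * b - 1) / 8 = (b * b - 1) / 2 / 4 by rw [Nat.div_div_eq_div_mul]]
    congr 2
    rw [← card_block_colour (r := r) (s := s) hb q hq, ← image_coords_filter (n := n) (m := m)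
      (fun c => (c ∈ Finset.Ico r (r + b) ×ˢ Finset.Ico s (s + b) ∧
        (2 * c.1 + 1 = 2 * r + b → 2 * c.2 + 1 ≠ 2 * s + b)) ∧ (c.1 + c.2) % 2 = q),
      ← Finset.card_map (Function.Embedding.subtype _)]
    · congr 1
      ext p
      simp only [Finset.mem_map, Perm.mem_support, Function.Embedding.subtype_apply,
        Finset.mem_filter, Finset.mem_univ, true_and, ← blockRot_ne_self_iff hr hs p]
      constructor
      · rintro ⟨a, ha, rfl⟩
        exact ⟨fun hc => ha (Subtype.ext hc), a.2⟩
      · rintro ⟨h1, h2⟩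
        exact ⟨⟨p, h2⟩, fun hc => h1 (congrArg Subtype.val hc), rfl⟩
    · rintro ⟨i, j⟩ hc
      simp only [Finset.mem_product, Finset.mem_Ico] at hc
      simp only
      omega
    · rintro ⟨i, j⟩
      simp only [Finset.mem_filter, Finset.mem_erase, Finset.mem_product, Finset.mem_Ico, ne_eq,
        Prod.mk.injEq]
      omega
  · rw [Perm.subtypePerm_pow]
    ext1 p
    apply Subtype.ext
    simp only [Perm.subtypePerm_apply, blockRot_pow_four, Perm.one_apply]
  · intro p hp
    exact Subtype.ext (blockRot_eq_self_of_sq hr hs p.1 (congrArg Subtype.val hp))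

end Signs

/-! ### From linked classes and signs to the solvable configurations -/

section Main

variable {n m b : ℕ}

theorem subset_colours {σ : Perm (Square n m)} (h : ∀ p, parity (σ p) = parity p) (q : ℕ)
    (p : Square n m) : parity (σ p) = q ↔ parity p = q := by rw [h]

/-- The restriction to the squares of one colour of a permutation that preserves colours. -/
def colourPerm (σ : Perm (Square n m)) (h : ∀ p, parity (σ p) = parity p) (q : ℕ) :
    Perm {p : Square n m // parity p = q} :=
  Perm.subtypePerm (p := fun p : Square n m => parity p = q) σ (subset_colours h q)

theorem colourPerm_mul {σ τ : Perm (Square n m)} (hσ : ∀ p, parity (σ p) = parity p)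
    (hτ : ∀ p, parity (τ p) = parity p) (hστ : ∀ p, parity ((σ * τ) p) = parity p) (q : ℕ) :
    colourPerm (σ * τ) hστ q = colourPerm σ hσ q * colourPerm τ hτ q := rfl

theorem ofSubtype_colourPerm_mul {σ : Perm (Square n m)} (h : ∀ p, parity (σ p) = parity p) :
    Perm.ofSubtype (colourPerm σ h 0) * Perm.ofSubtype (colourPerm σ h 1) = σ := by
  ext1 p
  rw [Perm.mul_apply]
  by_cases hp : parity p = 0
  · rw [Perm.ofSubtype_apply_of_not_mem (colourPerm σ h 1) (by omega),
      Perm.ofSubtype_apply_of_mem (colourPerm σ h 0) hp]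
    rfl
  · have hp1 : parity p = 1 := by
      simp only [parity] at hp ⊢
      omega
    rw [Perm.ofSubtype_apply_of_mem (colourPerm σ h 1) hp1,
      Perm.ofSubtype_apply_of_not_mem (colourPerm σ h 0)]
    · rfl
    · change ¬ parity (σ p) = 0
      rwa [h]

theorem sign_eq_mul_colourPerm {σ : Perm (Square n m)} (h : ∀ p, parity (σ p) = parity p) :
    Perm.sign σ = Perm.sign (colourPerm σ h 0) * Perm.sign (colourPerm σ h 1) := by
  conv_lhs => rw [← ofSubtype_colourPerm_mul h, map_mul, Perm.sign_ofSubtype, Perm.sign_ofSubtype]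

theorem mem_of_colourPerm (hc : Conn b n m) {σ : Perm (Square n m)}
    (h : ∀ p, parity (σ p) = parity p) (h0 : Perm.sign (colourPerm σ h 0) = 1)
    (h1 : Perm.sign (colourPerm σ h 1) = 1) : σ ∈ rotGroup b n m := by
  rw [← ofSubtype_colourPerm_mul h]
  refine mul_mem (ofSubtype_mem_of_linked (fun x y hx hy => hc x y (Or.inr ?_)) _ h0)
    (ofSubtype_mem_of_linked (fun x y hx hy => hc x y (Or.inr ?_)) _ h1) <;> rw [hx, hy]

theorem parity_of_mem (hb : b % 2 = 1) {σ : Perm (Square n m)} (h : σ ∈ rotGroup b n m) :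
    ∀ p, parity (σ p) = parity p := by
  induction h using Subgroup.closure_induction with
  | mem σ hσ =>
    obtain ⟨r, s, hr, hs, rfl⟩ := hσ
    exact parity_blockRot hr hs hb
  | one => exact fun p => rfl
  | mul x y _ _ hx hy => exact fun p => (hx _).trans (hy p)
  | inv x _ hx =>
    intro p
    rw [← hx, perm_apply_inv]

theorem sign_of_mem {H : Subgroup ℤˣ} (h : ∀ (r s : ℕ) (hr : r + b ≤ n) (hs : s + b ≤ m),
    Perm.sign (blockRot hr hs : Perm (Square n m)) ∈ H) {σ : Perm (Square n m)}
    (hσ : σ ∈ rotGroup b n m) : Perm.sign σ ∈ H := by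
  suffices hle : rotGroup b n m ≤ H.comap Perm.sign from hle hσ
  rw [rotGroup, Subgroup.closure_le]
  rintro _ ⟨r, s, hr, hs, rfl⟩
  exact h r s hr hs

theorem sign_colourPerm_of_mem (hb : b % 2 = 1) (h8 : ((-1 : ℤˣ)) ^ ((b * b - 1) / 8) = 1)
    {q : ℕ} (hq : q < 2) {σ : Perm (Square n m)} (hσ : σ ∈ rotGroup b n m)
    (h : ∀ p, parity (σ p) = parity p) : Perm.sign (colourPerm σ h q) = 1 := by
  induction hσ using Subgroup.closure_induction with
  | mem σ hσ =>
    obtain ⟨r, s, hr, hs, rfl⟩ := hσ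
    rw [← h8]
    exact sign_blockRot_subtypePerm hr hs hb hq _
  | one => exact map_one Perm.sign
  | mul x y hx' hy' hx hy =>
    rw [colourPerm_mul (parity_of_mem hb hx') (parity_of_mem hb hy'), map_mul,
      hx (parity_of_mem hb hx'), hy (parity_of_mem hb hy'), mul_one]
  | inv x hx' hx =>
    have h1 := colourPerm_mul h (parity_of_mem hb hx')
      (by rw [inv_mul_cancel]; exact fun _ => rfl) q
    have h2 := congrArg Perm.sign h1
    rw [map_mul, hx (parity_of_mem hb hx'), mul_one] at h2
    rw [← h2]
    simp only [inv_mul_cancel]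
    exact map_one Perm.sign

/-- Here `b * b / 4` is odd, so one rotation turns an odd permutation into an even one. -/
theorem solvable_of_conn_two (hb : b % 4 = 2) (hn : b ≤ n) (hm : b ≤ m) (hc : Conn b n m)
    (c : Config n m) : Solvable b c := by
  rw [solvable_iff]
  have hmem : ∀ τ : Perm (Square n m), Perm.sign τ = 1 → τ ∈ rotGroup b n m :=
    mem_of_linked fun x y => hc x y (Or.inl (by omega))
  have hρ : (blockRot (b := b) (r := 0) (s := 0) (by omega) (by omega) : Perm (Square n m)) ∈
    rotGroup b n m := blockRot_mem _ _
  have hsign := sign_blockRot_of_even (n := n) (m := m) (b := b) (r := 0) (s := 0) (by omega)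
    (by omega) (by omega)
  have hodd : b * b / 4 % 2 = 1 := by
    obtain ⟨k, rfl⟩ : ∃ k, b = 4 * k + 2 := ⟨b / 4, by omega⟩
    rw [show (4 * k + 2) * (4 * k + 2) = (2 * (2 * k * k + 2 * k) + 1) * 4 by ring,
      Nat.mul_div_cancel _ (by norm_num)]
    omega
  rw [Odd.neg_one_pow (Nat.odd_iff.mpr hodd)] at hsign
  rcases Int.units_eq_one_or (Perm.sign (toPerm c)) with h | h
  · exact hmem _ h
  · have h1 := hmem (toPerm c * blockRot (b := b) (r := 0) (s := 0) (by omega) (by omega))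
      (by rw [map_mul, h, hsign]; rfl)
    exact (Subgroup.mul_mem_cancel_right _ hρ).mp h1

theorem solvable_iff_of_conn_zero (hb : b % 4 = 0) (hc : Conn b n m) (c : Config n m) :
    Solvable b c ↔ IsEven c := by
  rw [solvable_iff]
  constructor
  · intro h
    refine (Subgroup.mem_bot.mp (sign_of_mem (H := ⊥) (fun r s hr hs => ?_) h) : _)
    rw [Subgroup.mem_bot, sign_blockRot_of_even hr hs (by omega)]
    apply Even.neg_one_pow
    obtain ⟨k, rfl⟩ : ∃ k, b = 4 * k := ⟨b / 4, by omega⟩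
    rw [show 4 * k * (4 * k) = 2 * (2 * k * k) * 4 by ring, Nat.mul_div_cancel _ (by norm_num)]
    exact even_two_mul _
  · exact mem_of_linked (fun x y => hc x y (Or.inl (by omega))) _

/-- Every rotation is odd on both colours, hence even overall. Conversely, an even permutation
preserving colours has equal signs on them, and if both are `-1` a single rotation corrects both. -/
theorem solvable_iff_of_conn_three (hb : b % 8 = 3 ∨ b % 8 = 5) (hn : b ≤ n) (hm : b ≤ m)
    (hc : Conn b n m) (c : Config n m) : Solvable b c ↔ IsEven c ∧ CorrectParity c := by
  rw [solvable_iff]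
  have hb1 : b % 2 = 1 := by omega
  have hodd : (-1 : ℤˣ) ^ ((b * b - 1) / 8) = -1 := by
    apply Odd.neg_one_pow
    rcases hb with hb | hb
    · obtain ⟨k, rfl⟩ : ∃ k, b = 8 * k + 3 := ⟨b / 8, by omega⟩
      rw [show (8 * k + 3) * (8 * k + 3) = (2 * (4 * k * k + 3 * k) + 1) * 8 + 1 by ring,
        Nat.add_sub_cancel, Nat.mul_div_cancel _ (by norm_num)]
      exact odd_two_mul_add_one _
    · obtain ⟨k, rfl⟩ : ∃ k, b = 8 * k + 5 := ⟨b / 8, by omega⟩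
      rw [show (8 * k + 5) * (8 * k + 5) = (2 * (4 * k * k + 5 * k + 1) + 1) * 8 + 1 by ring,
        Nat.add_sub_cancel, Nat.mul_div_cancel _ (by norm_num)]
      exact odd_two_mul_add_one _
  have hrot : ∀ {r s : ℕ} (hr : r + b ≤ n) (hs : s + b ≤ m) (q : ℕ), q < 2 →
      Perm.sign (colourPerm (blockRot hr hs) (parity_blockRot hr hs hb1) q) = -1 := by
    intro r s hr hs q hq
    rw [← hodd]
    exact sign_blockRot_subtypePerm hr hs hb1 hq _
  constructor
  · intro h
    refine ⟨Subgroup.mem_bot.mp (sign_of_mem (H := ⊥) (fun r s hr hs => ?_) h),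
      parity_of_mem hb1 h⟩
    rw [Subgroup.mem_bot, sign_eq_mul_colourPerm (parity_blockRot hr hs hb1),
      hrot hr hs 0 (by norm_num), hrot hr hs 1 (by norm_num)]
    rfl
  · rintro ⟨h1, h2⟩
    have h3 : Perm.sign (toPerm c) = 1 := h1
    rw [sign_eq_mul_colourPerm h2] at h3
    rcases Int.units_eq_one_or (Perm.sign (colourPerm (toPerm c) h2 0)) with h | h
    · rw [h, one_mul] at h3
      exact mem_of_colourPerm hc h2 h h3
    · have h4 : Perm.sign (colourPerm (toPerm c) h2 1) = -1 := by
        rw [h] at h3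
        simpa [neg_eq_iff_eq_neg] using h3
      have hr : 0 + b ≤ n := by omega
      have hs : 0 + b ≤ m := by omega
      have hp := parity_blockRot hr hs hb1
      have h5 : ∀ p, parity ((toPerm c * blockRot hr hs) p) = parity p :=
        fun p => (h2 _).trans (hp p)
      have h6 := mem_of_colourPerm hc h5
        (by rw [colourPerm_mul h2 hp, map_mul, h, hrot hr hs 0 (by norm_num)]; rfl)
        (by rw [colourPerm_mul h2 hp, map_mul, h4, hrot hr hs 1 (by norm_num)]; rfl)
      exact (Subgroup.mul_mem_cancel_right _ (blockRot_mem hr hs)).mp h6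

theorem solvable_iff_of_conn_one (hb : b % 8 = 1 ∨ b % 8 = 7) (hc : Conn b n m)
    (c : Config n m) : Solvable b c ↔ IsEvenOn 0 c ∧ IsEvenOn 1 c := by
  rw [solvable_iff]
  have hb1 : b % 2 = 1 := by omega
  have heven : (-1 : ℤˣ) ^ ((b * b - 1) / 8) = 1 := by
    apply Even.neg_one_pow
    rcases hb with hb | hb
    · obtain ⟨k, rfl⟩ : ∃ k, b = 8 * k + 1 := ⟨b / 8, by omega⟩
      rw [show (8 * k + 1) * (8 * k + 1) = 2 * (4 * k * k + k) * 8 + 1 by ring,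
        Nat.add_sub_cancel, Nat.mul_div_cancel _ (by norm_num)]
      exact even_two_mul _
    · obtain ⟨k, rfl⟩ : ∃ k, b = 8 * k + 7 := ⟨b / 8, by omega⟩
      rw [show (8 * k + 7) * (8 * k + 7) = 2 * (4 * k * k + 7 * k + 3) * 8 + 1 by ring,
        Nat.add_sub_cancel, Nat.mul_div_cancel _ (by norm_num)]
      exact even_two_mul _
  constructor
  · intro h
    have hp := parity_of_mem hb1 h
    exact ⟨⟨subset_colours hp 0, sign_colourPerm_of_mem hb1 heven (by norm_num) h hp⟩,
      ⟨subset_colours hp 1, sign_colourPerm_of_mem hb1 heven (by norm_num) h hp⟩⟩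
  · rintro ⟨⟨h0, h0'⟩, ⟨h1, h1'⟩⟩
    have hp : ∀ p, parity (toPerm c p) = parity p := by
      intro p
      have := h0 p
      have := h1 p
      have : parity p < 2 := Nat.mod_lt _ (by norm_num)
      have : parity (toPerm c p) < 2 := Nat.mod_lt _ (by norm_num)
      omega
    exact mem_of_colourPerm hc hp h0' h1'

theorem solvable_one_iff (c : Config n m) : Solvable 1 c ↔ c = solved n m := by
  rw [solvable_iff]
  constructor
  · intro h
    suffices hle : rotGroup 1 n m ≤ ⊥ by
      apply toPerm_injective
      rw [toPerm_solved]
      exact Subgroup.mem_bot.mp (hle h)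
    rw [rotGroup, Subgroup.closure_le]
    rintro _ ⟨r, s, hr, hs, rfl⟩
    rw [SetLike.mem_coe, Subgroup.mem_bot]
    ext1 p
    apply coords_injective
    rw [coords_blockRot, Perm.one_apply]
    generalize coords p = q
    obtain ⟨i, j⟩ := q
    by_cases h : (r ≤ i ∧ i < r + 1) ∧ (s ≤ j ∧ j < s + 1)
    · rw [rotFun_of_mem h, Prod.mk.injEq]
      omega
    · exact if_neg h
  · rintro rfl
    rw [toPerm_solved]
    exact one_mem _

/-- The rotation of the whole square board. -/
def boardRot (n : ℕ) : Perm (Square n n) :=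
  blockRot (b := n) (r := 0) (s := 0) (by omega) (by omega)

theorem rotateBoard_eq (c : Config n n) : rotateBoard c = ((boardRot n)⁻¹ : Perm _).trans c := by
  ext1 p
  change c (p.2, Fin.rev p.1) = c ((boardRot n)⁻¹ p)
  congr 1
  apply coords_injective
  have h1 := p.1.isLt
  have h2 := p.2.isLt
  rw [boardRot, coords_blockRot_inv, rotFunInv, if_pos (by simp only [coords]; omega)]
  simp only [coords, Fin.val_rev, Prod.mk.injEq]
  omega

theorem solvable_board_iff (c : Config n n) :
    Solvable n c ↔ ∃ k < 4, toPerm c = (boardRot n)⁻¹ ^ k := by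
  have h4 : (boardRot n)⁻¹ ^ 4 = 1 := by
    rw [inv_pow, boardRot, blockRot_pow_four, inv_one]
  have hG : rotGroup n n n = Subgroup.zpowers (boardRot n)⁻¹ := by
    rw [Subgroup.zpowers_inv, Subgroup.zpowers_eq_closure, rotGroup]
    congr 1
    ext σ
    constructor
    · rintro ⟨r, s, hr, hs, rfl⟩
      obtain rfl : r = 0 := by omega
      obtain rfl : s = 0 := by omega
      rfl
    · rintro rfl
      exact ⟨0, 0, by omega, by omega, rfl⟩
  rw [solvable_iff, hG, Subgroup.mem_zpowers_iff]
  constructor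
  · rintro ⟨k, hk⟩
    refine ⟨(k % 4).toNat, by omega, ?_⟩
    rw [← hk, ← zpow_natCast, Int.toNat_of_nonneg (by omega)]
    conv_lhs => rw [← Int.emod_add_mul_ediv k 4, zpow_add, zpow_mul]
    rw [show (boardRot n)⁻¹ ^ (4 : ℤ) = 1 from h4, one_zpow, mul_one]
  · rintro ⟨k, -, hk⟩
    exact ⟨k, by rw [hk, zpow_natCast]⟩

theorem solvable_board (n : ℕ) (hn : 2 ≤ n) :
    {c : Config n n | Solvable n c} =
      {solved n n, rotateBoard (solved n n), rotateBoard (rotateBoard (solved n n)),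
        rotateBoard (rotateBoard (rotateBoard (solved n n)))} ∧
    {c : Config n n | Solvable n c}.ncard = 4 := by
  set ρ := (boardRot n)⁻¹ with hρ
  have e0 : toPerm (solved n n) = ρ ^ 0 := toPerm_solved
  have e1 : toPerm (rotateBoard (solved n n)) = ρ ^ 1 := by
    rw [rotateBoard_eq, toPerm_trans, toPerm_solved, one_mul, pow_one]
  have e2 : toPerm (rotateBoard (rotateBoard (solved n n))) = ρ ^ 2 := by
    rw [rotateBoard_eq, toPerm_trans, e1, pow_one, pow_two]
  have e3 : toPerm (rotateBoard (rotateBoard (rotateBoard (solved n n)))) = ρ ^ 3 := by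
    rw [rotateBoard_eq, toPerm_trans, e2, ← hρ, ← pow_succ]
  have heq : {c : Config n n | Solvable n c} =
      {solved n n, rotateBoard (solved n n), rotateBoard (rotateBoard (solved n n)),
        rotateBoard (rotateBoard (rotateBoard (solved n n)))} := by
    ext c
    rw [Set.mem_ofPred_eq, solvable_board_iff]
    simp only [Set.mem_insert_iff, Set.mem_singleton_iff, ← toPerm_injective.eq_iff, e0, e1, e2,
      e3, ← hρ]
    constructor
    · rintro ⟨k, hk, h⟩
      rw [h]
      interval_cases k <;> simp
    · rintro (h | h | h | h)
      exacts [⟨0, by norm_num, h⟩, ⟨1, by norm_num, h⟩, ⟨2, by norm_num, h⟩, ⟨3, by norm_num, h⟩]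
  refine ⟨heq, ?_⟩
  have hcorner : ∀ p : Square n n, coords (ρ p) = ((coords p).2, n - 1 - (coords p).1) := by
    intro p
    have h1 : (coords p).1 < n := p.1.isLt
    have h2 : (coords p).2 < n := p.2.isLt
    rw [hρ, boardRot, coords_blockRot_inv, rotFunInv, if_pos (by omega)]
    ext <;> simp
  -- The four powers of `ρ` send this corner to the four corners, which are distinct since `2 ≤ n`.
  obtain ⟨p, hp⟩ : ∃ p : Square n n, coords p = (0, 0) :=
    ⟨(⟨0, by omega⟩, ⟨0, by omega⟩), rfl⟩
  have c0 : coords ((ρ ^ 0) p) = (0, 0) := hp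
  have c1 : coords ((ρ ^ 1) p) = (0, n - 1) := by rw [pow_one, hcorner, hp]; rfl
  have c2 : coords ((ρ ^ 2) p) = (n - 1, n - 1) := by
    rw [pow_succ', Perm.mul_apply, hcorner, c1]; rfl
  have c3 : coords ((ρ ^ 3) p) = (n - 1, 0) := by
    rw [pow_succ', Perm.mul_apply, hcorner, c2]; simp
  have hne : ∀ {c d : Config n n} {σ τ : Perm (Square n n)}, toPerm c = σ → toPerm d = τ →
      coords (σ p) ≠ coords (τ p) → c ≠ d := by
    rintro c d _ _ rfl rfl h rfl
    exact h rfl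
  rw [heq, Set.ncard_insert_of_notMem, Set.ncard_insert_of_notMem, Set.ncard_pair]
  · exact hne e2 e3 (by rw [c2, c3, ne_eq, Prod.mk.injEq]; omega)
  · simp only [Set.mem_insert_iff, Set.mem_singleton_iff, not_or]
    exact ⟨hne e1 e2 (by rw [c1, c2, ne_eq, Prod.mk.injEq]; omega),
      hne e1 e3 (by rw [c1, c3, ne_eq, Prod.mk.injEq]; omega)⟩
  · simp only [Set.mem_insert_iff, Set.mem_singleton_iff, not_or]
    exact ⟨hne e0 e1 (by rw [c0, c1, ne_eq, Prod.mk.injEq]; omega),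
      hne e0 e2 (by rw [c0, c2, ne_eq, Prod.mk.injEq]; omega),
      hne e0 e3 (by rw [c0, c3, ne_eq, Prod.mk.injEq]; omega)⟩

end Main

/-! ### The `2 × 3` board and the projective line over the field with five elements -/

section TwoByThree

/-- Homogeneous coordinates on the projective line over the field with five elements, assigned to
the squares of the `2 × 3` board in such a way that the rotations are projective maps. -/
def projLabel (p : Square 2 3) : ℤ × ℤ :=
  match p.1.val * 3 + p.2.val with
  | 0 => (1, 0)
  | 1 => (0, 1)
  | 2 => (1, 1)
  | 3 => (4, 1)
  | 4 => (2, 1)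
  | _ => (3, 1)

/-- The determinant of the labels of two squares. -/
def labelDet (p q : Square 2 3) : ℤ :=
  (projLabel p).1 * (projLabel q).2 - (projLabel p).2 * (projLabel q).1

/-- The cross-ratio of the labels is `-1`. -/
abbrev Harmonic (p q r s : Square 2 3) : Prop :=
  (labelDet p r * labelDet q s + labelDet p s * labelDet q r) % 5 = 0

theorem harmonic_rotAt : ∀ j < 2, ∀ p q r s : Square 2 3,
    Harmonic (rotAt 2 2 3 0 j p) (rotAt 2 2 3 0 j q) (rotAt 2 2 3 0 j r) (rotAt 2 2 3 0 j s) ↔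
      Harmonic p q r s := by
  decide +kernel

theorem harmonic_of_mem {σ : Perm (Square 2 3)} (hσ : σ ∈ rotGroup 2 2 3) :
    ∀ p q r s, Harmonic (σ p) (σ q) (σ r) (σ s) ↔ Harmonic p q r s := by
  induction hσ using Subgroup.closure_induction with
  | mem σ hσ =>
    obtain ⟨r, s, hr, hs, rfl⟩ := hσ
    obtain rfl : r = 0 := by omega
    have h := harmonic_rotAt s (by omega)
    rwa [rotAt, dif_pos ⟨hr, hs⟩] at h
  | one => exact fun _ _ _ _ => Iff.rfl
  | mul x y _ _ hx hy => exact fun p q r s => (hx _ _ _ _).trans (hy p q r s)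
  | inv x _ hx =>
    intro p q r s
    rw [← hx]
    simp only [perm_apply_inv]

/-- Each of the other three squares is the harmonic conjugate of one of the fixed squares with
respect to the other two, and is determined by this relation, which the rotations preserve. -/
theorem eq_one_of_fixes_three {σ : Perm (Square 2 3)} (hσ : σ ∈ rotGroup 2 2 3)
    (h0 : σ (0, 0) = (0, 0)) (h1 : σ (0, 1) = (0, 1)) (h2 : σ (0, 2) = (0, 2)) : σ = 1 := by
  have key : ∀ x : Square 2 3, x = (0, 0) ∨ x = (0, 1) ∨ x = (0, 2) ∨
      (∀ y, Harmonic (0, 0) (0, 1) (0, 2) x → Harmonic (0, 0) (0, 1) (0, 2) y → y = x) ∧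
      (∀ y, Harmonic (0, 1) (0, 2) (0, 0) x → Harmonic (0, 1) (0, 2) (0, 0) y → y = x) ∧
      (∀ y, Harmonic (0, 2) (0, 0) (0, 1) x → Harmonic (0, 2) (0, 0) (0, 1) y → y = x) ∧
      (Harmonic (0, 0) (0, 1) (0, 2) x ∨ Harmonic (0, 1) (0, 2) (0, 0) x ∨
        Harmonic (0, 2) (0, 0) (0, 1) x) := by
    decide +kernel
  have hh := harmonic_of_mem hσ
  ext1 x
  rw [Perm.one_apply]
  rcases key x with rfl | rfl | rfl | ⟨k1, k2, k3, h | h | h⟩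
  · exact h0
  · exact h1
  · exact h2
  · refine k1 _ h ?_
    have := (hh _ _ _ _).mpr h
    rwa [h0, h1, h2] at this
  · refine k2 _ h ?_
    have := (hh _ _ _ _).mpr h
    rwa [h0, h1, h2] at this
  · refine k3 _ h ?_
    have := (hh _ _ _ _).mpr h
    rwa [h0, h1, h2] at this

/-- Transitivity is checked along a chain of stabilisers: on all squares, then fixing `(0, 0)`, then
fixing `(0, 1)` as well. -/
theorem exists_mem_apply_triple {p q r : Square 2 3} (hpq : p ≠ q) (hqr : q ≠ r) (hpr : p ≠ r) :
    ∃ σ ∈ rotGroup 2 2 3, σ p = (0, 0) ∧ σ q = (0, 1) ∧ σ r = (0, 2) := by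
  have t1 : ∀ p : Square 2 3, ∃ l ∈ ([[],
    [(0, 0, true)],
    [(0, 0, true), (0, 1, true)],
    [(0, 0, false)],
    [(0, 0, true), (0, 0, true)],
    [(0, 0, true), (0, 0, true), (0, 1, false)]] : List (List (ℕ × ℕ × Bool))),
      rotWord 2 2 3 l p = (0, 0) := by
    decide +kernel
  have t2 : ∀ q : Square 2 3, q ≠ (0, 0) → ∃ l ∈ ([[],
    [(0, 1, true)],
    [(0, 1, false), (0, 0, false), (0, 1, false), (0, 0, true)],
    [(0, 1, false)],
    [(0, 1, true), (0, 1, true)]] : List (List (ℕ × ℕ × Bool))),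
      rotWord 2 2 3 l (0, 0) = (0, 0) ∧ rotWord 2 2 3 l q = (0, 1) := by
    decide +kernel
  have t3 : ∀ r : Square 2 3, r ≠ (0, 0) → r ≠ (0, 1) →
      ∃ l ∈ ([[],
    [(0, 0, false), (0, 1, true), (0, 1, true), (0, 0, true)],
    [(0, 0, false), (0, 1, false), (0, 0, true)],
    [(0, 0, false), (0, 1, true), (0, 0, true)]] : List (List (ℕ × ℕ × Bool))),
      rotWord 2 2 3 l (0, 0) = (0, 0) ∧ rotWord 2 2 3 l (0, 1) = (0, 1) ∧
        rotWord 2 2 3 l r = (0, 2) := by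
    decide +kernel
  obtain ⟨l1, -, h1⟩ := t1 p
  set σ1 := rotWord 2 2 3 l1
  obtain ⟨l2, -, h2, h2'⟩ := t2 (σ1 q) (by rw [← h1]; exact σ1.injective.ne hpq.symm)
  set σ2 := rotWord 2 2 3 l2
  obtain ⟨l3, -, h3, h3', h3''⟩ := t3 (σ2 (σ1 r))
    (by rw [← h2, ← h1]; exact σ2.injective.ne (σ1.injective.ne hpr.symm))
    (by rw [← h2']; exact σ2.injective.ne (σ1.injective.ne hqr.symm))
  refine ⟨rotWord 2 2 3 l3 * σ2 * σ1,
    mul_mem (mul_mem (rotWord_mem _ _ _ _) (rotWord_mem _ _ _ _)) (rotWord_mem _ _ _ _), ?_, ?_, ?_⟩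
  · rw [Perm.mul_apply, Perm.mul_apply, h1, h2, h3]
  · rw [Perm.mul_apply, Perm.mul_apply, h2', h3']
  · rw [Perm.mul_apply, Perm.mul_apply, h3'']

theorem card_rotGroup_two_three : Nat.card (rotGroup 2 2 3) = 120 := by
  let T := {t : Square 2 3 × Square 2 3 × Square 2 3 // t.1 ≠ t.2.1 ∧ t.2.1 ≠ t.2.2 ∧ t.1 ≠ t.2.2}
  have hT : Nat.card T = 120 := by
    rw [Nat.card_eq_fintype_card]
    decide +kernel
  rw [← hT]
  refine Nat.card_congr (Equiv.ofBijective (fun σ => (⟨(σ.1 (0, 0), σ.1 (0, 1), σ.1 (0, 2)),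
    σ.1.injective.ne (by decide), σ.1.injective.ne (by decide),
    σ.1.injective.ne (by decide)⟩ : T)) ⟨?_, ?_⟩)
  · intro σ τ h
    simp only [T, Subtype.mk.injEq, Prod.mk.injEq] at h
    obtain ⟨h0, h1, h2⟩ := h
    have := eq_one_of_fixes_three (mul_mem (inv_mem τ.2) σ.2)
      (by rw [Perm.mul_apply, h0, perm_inv_apply]) (by rw [Perm.mul_apply, h1, perm_inv_apply])
      (by rw [Perm.mul_apply, h2, perm_inv_apply])
    exact Subtype.ext (inv_mul_eq_one.mp this).symm
  · rintro ⟨⟨p, q, r⟩, hpq, hqr, hpr⟩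
    obtain ⟨σ, hσ, h0, h1, h2⟩ := exists_mem_apply_triple hpq hqr hpr
    refine ⟨⟨σ⁻¹, inv_mem hσ⟩, Subtype.ext ?_⟩
    simp only [← h0, ← h1, ← h2, perm_inv_apply]

end TwoByThree

/-! ### The `3 × 4` board and the exceptional correspondence of degree six -/

section ThreeByFour

/-- The index of a square of the `3 × 4` board among the squares of its colour. -/
def colourIndex (p : Square 3 4) : ℕ := (p.1.val * 4 + p.2.val) / 2

/-- The fixed-point-free involution of the even squares of the `3 × 4` board that belongs to a pair
of odd squares; the `k`-th decimal digit is the index of the partner of the `k`-th even square. -/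
def involutionCode : List (List ℕ) :=
  -- The diagonal codes stand for the identity. The 15 pairs of distinct odd squares get the 15
  -- fixed-point-free involutions, and a five-digit code has leading digit 0.
  [[543210, 120453, 315042, 34125, 452301, 201534],
   [120453, 543210, 234501, 451032, 305124, 12345],
   [315042, 234501, 543210, 102354, 21435, 450123],
   [34125, 451032, 102354, 543210, 210543, 325401],
   [452301, 305124, 21435, 210543, 543210, 134052],
   [201534, 12345, 450123, 325401, 134052, 543210]]

/-- The even squares `p`, `p'` are interchanged by the involution of the odd squares `o`, `o'`. -/
abbrev Partner (o o' p p' : Square 3 4) : Prop :=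
  ((involutionCode.getD (colourIndex o) []).getD (colourIndex o') 0) / 10 ^ colourIndex p % 10 =
    colourIndex p'

/-- The squares of colour `q` of the `3 × 4` board. -/
abbrev ColourSquare (q : ℕ) := {p : Square 3 4 // parity p = q}

theorem partner_rotAt : ∀ j < 2, ∀ o o' : ColourSquare 1, ∀ p p' : ColourSquare 0,
    (Partner (rotAt 3 3 4 0 j o) (rotAt 3 3 4 0 j o') (rotAt 3 3 4 0 j p) (rotAt 3 3 4 0 j p') ↔
      Partner o o' p p') := by
  decide +kernel

theorem partner_of_mem {σ : Perm (Square 3 4)} (hσ : σ ∈ rotGroup 3 3 4) :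
    ∀ o o' p p' : Square 3 4, parity o = 1 → parity o' = 1 → parity p = 0 → parity p' = 0 →
      (Partner (σ o) (σ o') (σ p) (σ p') ↔ Partner o o' p p') := by
  induction hσ using Subgroup.closure_induction with
  | mem σ hσ =>
    obtain ⟨r, s, hr, hs, rfl⟩ := hσ
    obtain rfl : r = 0 := by omega
    intro o o' p p' ho ho' hp hp'
    have h := partner_rotAt s (by omega) ⟨o, ho⟩ ⟨o', ho'⟩ ⟨p, hp⟩ ⟨p', hp'⟩
    rwa [rotAt, dif_pos ⟨hr, hs⟩] at h
  | one => exact fun _ _ _ _ _ _ _ _ => Iff.rfl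
  | mul x y _ hy' hx hy =>
    intro o o' p p' ho ho' hp hp'
    have hpar := parity_of_mem rfl hy'
    exact (hx _ _ _ _ (by rw [hpar, ho]) (by rw [hpar, ho']) (by rw [hpar, hp])
      (by rw [hpar, hp'])).trans (hy o o' p p' ho ho' hp hp')
  | inv x hx' hx =>
    intro o o' p p' ho ho' hp hp'
    have hpar := parity_of_mem rfl (inv_mem hx')
    rw [← hx _ _ _ _ (by rw [hpar, ho]) (by rw [hpar, ho']) (by rw [hpar, hp])
      (by rw [hpar, hp'])]
    simp only [perm_apply_inv]

/-- If `σ` fixes the even squares, the pairs `o`, `o'` and `σ o`, `σ o'` have the same involution.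
If `σ o ≠ o`, some `o'` makes this impossible, whatever `σ o'` is. -/
theorem fixes_odd_of_fixes_even {σ : Perm (Square 3 4)} (hσ : σ ∈ rotGroup 3 3 4)
    (h : ∀ p, parity p = 0 → σ p = p) : ∀ o, parity o = 1 → σ o = o := by
  have key : ∀ o u : ColourSquare 1, u ≠ o → ∃ o' : ColourSquare 1, ∀ v : ColourSquare 1,
      ∃ p p' : ColourSquare 0, Partner o o' p p' ∧ ¬ Partner u v p p' := by
    decide +kernel
  have hpar := parity_of_mem rfl hσ
  intro o ho
  by_contra hne
  obtain ⟨⟨o', ho'⟩, hv⟩ := key ⟨o, ho⟩ ⟨σ o, by rw [hpar, ho]⟩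
    fun hc => hne (congrArg Subtype.val hc)
  obtain ⟨⟨p, hp⟩, ⟨p', hp'⟩, h1, h2⟩ := hv ⟨σ o', by rw [hpar, ho']⟩
  have h3 := (partner_of_mem hσ o o' p p' ho ho' hp hp').mpr h1
  rw [h p hp, h p' hp'] at h3
  exact h2 h3

theorem fixes_even_of_fixes_odd {σ : Perm (Square 3 4)} (hσ : σ ∈ rotGroup 3 3 4)
    (h : ∀ o, parity o = 1 → σ o = o) : ∀ p, parity p = 0 → σ p = p := by
  have key : ∀ p u : ColourSquare 0, u ≠ p → ∃ p' : ColourSquare 0, ∀ v : ColourSquare 0,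
      ∃ o o' : ColourSquare 1, Partner o o' p p' ∧ ¬ Partner o o' u v := by
    decide +kernel
  have hpar := parity_of_mem rfl hσ
  intro p hp
  by_contra hne
  obtain ⟨⟨p', hp'⟩, hv⟩ := key ⟨p, hp⟩ ⟨σ p, by rw [hpar, hp]⟩
    fun hc => hne (congrArg Subtype.val hc)
  obtain ⟨⟨o, ho⟩, ⟨o', ho'⟩, h1, h2⟩ := hv ⟨σ p', by rw [hpar, hp']⟩
  have h3 := (partner_of_mem hσ o o' p p' ho ho' hp hp').mpr h1
  rw [h o ho, h o' ho'] at h3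
  exact h2 h3

/-- The permutations of the even squares of the `3 × 4` board induced by its rotations. -/
def evenPart : Subgroup (Perm (ColourSquare 0)) where
  carrier := {τ | ∃ σ ∈ rotGroup 3 3 4, ∀ p, σ p.1 = (τ p).1}
  mul_mem' := by
    rintro a b ⟨σ, hσ, h⟩ ⟨τ, hτ, h'⟩
    exact ⟨σ * τ, mul_mem hσ hτ, fun p => by rw [Perm.mul_apply, h', h, Perm.mul_apply]⟩
  one_mem' := ⟨1, one_mem _, fun _ => rfl⟩
  inv_mem' := by
    rintro a ⟨σ, hσ, h⟩
    exact ⟨σ⁻¹, inv_mem hσ, fun p => by rw [Perm.inv_eq_iff_eq, h, perm_apply_inv]⟩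

theorem colourPerm_mem_evenPart {σ : Perm (Square 3 4)} (hσ : σ ∈ rotGroup 3 3 4)
    (h : ∀ p, parity (σ p) = parity p) : colourPerm σ h 0 ∈ evenPart :=
  ⟨σ, hσ, fun _ => rfl⟩

/-- The rotation of the block with upper-left square `(0, j)` on the even squares. -/
def evenRot (j : ℕ) : Perm (ColourSquare 0) :=
  colourPerm (rotAt 3 3 4 0 j) (parity_of_mem rfl (rotAt_mem 3 3 4 0 j)) 0

theorem evenRot_mem (j : ℕ) : evenRot j ∈ evenPart :=
  colourPerm_mem_evenPart (rotAt_mem _ _ _ _ _) _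

theorem evenRot_word : evenRot 0 * evenRot 1 * (evenRot 0)⁻¹ * evenRot 1 =
    cycle3 ⟨(0, 0), rfl⟩ ⟨(1, 1), rfl⟩ ⟨(2, 2), rfl⟩ := by
  decide +kernel

theorem mem_iterate_grow_evenRot : ∀ p, p ∈ (fun T => [evenRot 0, evenRot 1].foldr grow T)^[6]
    ({⟨(0, 0), rfl⟩, ⟨(1, 1), rfl⟩, ⟨(2, 2), rfl⟩} : Finset (ColourSquare 0)) := by
  decide +kernel

theorem sign_evenRot_zero : Perm.sign (evenRot 0) = -1 := by
  have hr : (0 : ℕ) + 3 ≤ 3 := by norm_num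
  have hs : (0 : ℕ) + 3 ≤ 4 := by norm_num
  exact sign_blockRot_subtypePerm hr hs rfl (by norm_num)
    (subset_colours (parity_blockRot hr hs rfl) 0)

/-- One word is a 3-cycle on the even squares, and it links all six of them, which yields the
alternating group. A rotation supplies an odd permutation. -/
theorem evenPart_eq_top : evenPart = ⊤ := by
  have hmem := mul_mem (mul_mem (mul_mem (evenRot_mem 0) (evenRot_mem 1))
    (inv_mem (evenRot_mem 0))) (evenRot_mem 1)
  rw [evenRot_word] at hmem
  obtain ⟨h1, h2⟩ := linked_of_cycle3_mem (by decide) (by decide) (by decide) hmem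
  have hall : ∀ p, Linked evenPart ⟨(0, 0), rfl⟩ p := by
    intro p
    refine linked_iterate_grow ?_ (fun q hq => ?_) 6 p (mem_iterate_grow_evenRot p)
    · intro g hg
      rcases List.mem_pair.mp hg with hg | hg <;> rw [hg]
      exacts [evenRot_mem 0, evenRot_mem 1]
    · rcases Finset.mem_insert.mp hq with hq | hq
      · exact hq ▸ Linked.refl _
      · rcases Finset.mem_insert.mp hq with hq | hq
        · exact hq ▸ h1
        · exact Finset.mem_singleton.mp hq ▸ h2
  have halt := mem_of_linked fun p q => (hall p).symm.trans (hall q)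
  rw [eq_top_iff]
  rintro τ -
  rcases Int.units_eq_one_or (Perm.sign τ) with h | h
  · exact halt _ h
  · refine (Subgroup.mul_mem_cancel_right _ (evenRot_mem 0)).mp (halt _ ?_)
    rw [map_mul, h, sign_evenRot_zero]
    rfl

/-- Restriction to the even squares is onto by `evenPart_eq_top`, and faithful because an element
fixing all even squares fixes the odd ones too. -/
theorem card_rotGroup_three_four : Nat.card (rotGroup 3 3 4) = Nat.factorial 6 := by
  have hE : Nat.card (Perm {p : Square 3 4 // parity p = 0}) = Nat.factorial 6 := by
    rw [Nat.card_eq_fintype_card, Fintype.card_perm]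
    congr 1
  rw [← hE]
  refine Nat.card_congr (Equiv.ofBijective
    (fun σ => colourPerm σ.1 (parity_of_mem rfl σ.2) 0) ⟨?_, ?_⟩)
  · intro σ τ h
    have h0 : ∀ p, parity p = 0 → σ.1 p = τ.1 p := fun p hp =>
      congrArg Subtype.val (congrArg (fun f => f ⟨p, hp⟩) h)
    have hm := mul_mem (inv_mem τ.2) σ.2
    have h1 : ∀ p, parity p = 0 → (τ.1⁻¹ * σ.1) p = p := fun p hp => by
      rw [Perm.mul_apply, h0 p hp, perm_inv_apply]
    have h2 : τ.1⁻¹ * σ.1 = 1 := by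
      ext1 p
      rcases Nat.mod_two_eq_zero_or_one (p.1.val + p.2.val) with hp | hp
      · exact h1 p hp
      · exact fixes_odd_of_fixes_even hm h1 p hp
    exact Subtype.ext (inv_mul_eq_one.mp h2).symm
  · intro τ
    obtain ⟨σ, hσ, h⟩ : τ ∈ evenPart := evenPart_eq_top ▸ Subgroup.mem_top τ
    exact ⟨⟨σ, hσ⟩, Equiv.ext fun p => Subtype.ext (h p)⟩

theorem solvedOn_iff {n m : ℕ} (q : ℕ) (c : Config n m) :
    SolvedOn q c ↔ ∀ p, parity p = q → toPerm c p = p :=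
  forall₂_congr fun _ _ => (Equiv.symm_apply_eq (solved n m)).symm

theorem solvedOn_three_four {c : Config 3 4} (hc : Solvable 3 c) :
    SolvedOn 0 c ↔ SolvedOn 1 c := by
  rw [solvable_iff] at hc
  rw [solvedOn_iff, solvedOn_iff]
  exact ⟨fixes_odd_of_fixes_even hc, fixes_even_of_fixes_odd hc⟩

theorem solvedOn_four_three {c : Config 4 3} (hc : Solvable 3 c) :
    SolvedOn 0 c ↔ SolvedOn 1 c := by
  rw [solvable_iff] at hc
  have h := transposeHom_mem hc
  have key : ∀ q, SolvedOn q c ↔ ∀ p, parity p = q → transposeHom 4 3 (toPerm c) p = p := by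
    intro q
    rw [solvedOn_iff]
    constructor
    · intro h p hp
      rw [transposeHom_apply, h p.swap (by rwa [parity_swap]), Prod.swap_swap]
    · intro h p hp
      have := h p.swap (by rwa [parity_swap])
      rw [transposeHom_apply, Prod.swap_swap] at this
      exact Prod.swap_injective this
  rw [key, key]
  exact ⟨fixes_odd_of_fixes_even h, fixes_even_of_fixes_odd h⟩

end ThreeByFour

end NRP

theorem theorem1 :
    -- the case `b = n = m`
    (∀ n : ℕ, 2 ≤ n →
      {c : NRP.Config n n | NRP.Solvable n c} =
        {NRP.solved n n,
          NRP.rotateBoard (NRP.solved n n),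
          NRP.rotateBoard (NRP.rotateBoard (NRP.solved n n)),
          NRP.rotateBoard (NRP.rotateBoard (NRP.rotateBoard (NRP.solved n n)))} ∧
      {c : NRP.Config n n | NRP.Solvable n c}.ncard = 4) ∧
    -- the case `b = 1`
    (∀ n m : ℕ, 1 ≤ n → 1 ≤ m →
      ∀ c : NRP.Config n m, NRP.Solvable 1 c ↔ c = NRP.solved n m) ∧
    -- the remaining cases
    (∀ n m b : ℕ, 2 ≤ b → b ≤ n → b ≤ m → ¬ (b = n ∧ n = m) →
      (b = 2 →
        (((n = 2 ∧ m = 3) ∨ (n = 3 ∧ m = 2)) →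
          {c : NRP.Config n m | NRP.Solvable b c}.ncard = 120) ∧
        (¬ ((n = 2 ∧ m = 3) ∨ (n = 3 ∧ m = 2)) →
          ∀ c : NRP.Config n m, NRP.Solvable b c)) ∧
      (b = 3 →
        (((n = 3 ∧ m = 4) ∨ (n = 4 ∧ m = 3)) →
          {c : NRP.Config n m | NRP.Solvable b c}.ncard = Nat.factorial 6 ∧
          ∀ c : NRP.Config n m, NRP.Solvable b c →
            (NRP.SolvedOn 0 c ↔ NRP.SolvedOn 1 c)) ∧
        (¬ ((n = 3 ∧ m = 4) ∨ (n = 4 ∧ m = 3)) →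
          ∀ c : NRP.Config n m,
            NRP.Solvable b c ↔ NRP.IsEven c ∧ NRP.CorrectParity c)) ∧
      (4 ≤ b →
        ((b % 8 = 2 ∨ b % 8 = 6) →
          ∀ c : NRP.Config n m, NRP.Solvable b c) ∧
        ((b % 8 = 0 ∨ b % 8 = 4) →
          ∀ c : NRP.Config n m, NRP.Solvable b c ↔ NRP.IsEven c) ∧
        ((b % 8 = 3 ∨ b % 8 = 5) →
          ∀ c : NRP.Config n m,
            NRP.Solvable b c ↔ NRP.IsEven c ∧ NRP.CorrectParity c) ∧
        ((b % 8 = 1 ∨ b % 8 = 7) →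
          ∀ c : NRP.Config n m,
            NRP.Solvable b c ↔ NRP.IsEvenOn 0 c ∧ NRP.IsEvenOn 1 c))) := by
  refine ⟨NRP.solvable_board, fun n m _ _ => NRP.solvable_one_iff, ?_⟩
  intro n m b hb hn hm hne
  have conn := NRP.conn_of_two_le hb hn hm hne
  refine ⟨?_, ?_, fun hb4 => ?_⟩
  · rintro rfl
    refine ⟨?_, fun h => NRP.solvable_of_conn_two rfl hn hm (conn (fun _ => h) (by omega))⟩
    rintro (⟨rfl, rfl⟩ | ⟨rfl, rfl⟩)
    · rw [NRP.ncard_solvable, NRP.card_rotGroup_two_three]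
    · rw [NRP.ncard_solvable, NRP.card_rotGroup_transpose, NRP.card_rotGroup_two_three]
  · rintro rfl
    refine ⟨?_, fun h => NRP.solvable_iff_of_conn_three (Or.inl rfl) hn hm
      (conn (by omega) (fun _ => h))⟩
    rintro (⟨rfl, rfl⟩ | ⟨rfl, rfl⟩)
    · rw [NRP.ncard_solvable, NRP.card_rotGroup_three_four]
      exact ⟨rfl, fun c => NRP.solvedOn_three_four⟩
    · rw [NRP.ncard_solvable, NRP.card_rotGroup_transpose, NRP.card_rotGroup_three_four]
      exact ⟨rfl, fun c => NRP.solvedOn_four_three⟩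
  · have hc := conn (by omega) (by omega)
    exact ⟨fun h => NRP.solvable_of_conn_two (by omega) hn hm hc,
      fun h => NRP.solvable_iff_of_conn_zero (by omega) hc,
      fun h => NRP.solvable_iff_of_conn_three h hn hm hc,
      fun h => NRP.solvable_iff_of_conn_one h hc⟩
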